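/- **Setup.** Let $\mathcal H_A,\mathcal H_B$ be the spaces of $n_A$ and $n_B$ qubits, $d_A=2^{n_A}$, $d_B=2^{n_B}$, $d=d_Ad_B$. For a Pauli string $s\in\{I,X,Y,Z\}^n$ let $P_s=2^{-n/2}\,\sigma_{s_1}\otimes\cdots\otimes\sigma_{s_n}$ be the trace-normalized Pauli operator; $s$ is called real if it has an even number of $Y$ factors, and imaginary if it has an odd number. For an operator $X$ on $\mathcal H_A\otimes\mathcal H_B$ let $\alpha(X)_{st}=\operatorname{tr}[(P_s\otimes P_t)^\dagger X]$, a $d_A^2\times d_B^2$ matrix, and let $X^{t_{AB}}$ be the $d_A^2\times d_B^2$ matrix with entries $(X^{t_{AB}})_{(\alpha_A\beta_A)(\alpha_B\beta_B)}=X_{(\alpha_A\alpha_B)(\beta_A\beta_B)}$. The operator entanglement spectrum (OES) of $X$ consists of the $d_B^2$ eigenvalues, with multiplicity, of the Wishart matrix $(X^{t_{AB}})^\dagger X^{t_{AB}}$; its spectral distribution is the uniform probability measure on them. The GUE is the law of $(G+G^\dagger)/\sqrt2$, where $G$ is a $d\times d$ matrix with i.i.d. complex Gaussian entries of variance $1$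 (independent real and imaginary parts $N(0,\tfrac12)$), and the GOE is the law of the entrywise real part of a GUE matrix. Write $\|X\|_F=\sqrt{\operatorname{tr}(X^\dagger X)}$. For $0<\gamma\le1$ let $\mathrm{MP}_\gamma$ be the Marchenko–Pastur law, with density $$\frac{\sqrt{(\lambda_+-x)(x-\lambda_-)}}{2\pi\gamma x}\,\mathbf 1_{[\lambda_-,\lambda_+]}(x),\qquad \lambda_\pm=(1\pm\sqrt\gamma)^2 .$$ **Lemma.** 1. For every $n\ge 0$, with $D=2^n$, there are $D(D+1)/2$ real and $D(D-1)/2$ imaginary Pauli strings on $n$ qubits. 2. Let $M$ be drawn from the GOE on $\mathcal H_A\otimes\mathcal H_B$. Almost surely $\alpha(M)_{st}=0$ unless $s$ and $t$ are both real or both imaginary, and all entries of $\alpha(M)$ are real. Let $M_+=(\alpha(M)_{st})_{s,t\text{ real}}$ and $M_-=(\alpha(M)_{st})_{s,t\text{ imaginary}}$, of sizes $d_A^\pm\times d_B^\pm$ with $d_{A/B}^\pm=d_{A/B}(d_{A/B}\pm1)/2$. Then $M_+$ and $M_-$ are independent, and each has i.i.d. standard real Gaussian entries. 3. Almost surely $\alpha(M)^\dagger\alpha(M)=M_+^tM_++M_-^tM_-$,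 where $M_+^tM_+$ and $M_-^tM_-$ act on the spans of the real and of the imaginary Pauli strings of $B$ and are extended by zero. Consequently the OES of $M$ is, with multiplicity, the union of the spectra of $M_+^tM_+$ and $M_-^tM_-$: the characteristic polynomial of $(M^{t_{AB}})^\dagger M^{t_{AB}}$ is the product of theirs. 4. Let $0<\gamma\le1$ and let $(n_A,n_B)$ run through a sequence with $d\to\infty$ and $d_B^2/d_A^2\to\gamma$. If $M$ is drawn from the GOE, the spectral distribution of the OES of $\frac{d_B}{\|M\|_F}M$ converges weakly in probability to $\mathrm{MP}_\gamma$, i.e. its integral against any bounded continuous $f:\mathbb R\to\mathbb R$ converges in probability to $\int f\,d\mathrm{MP}_\gamma$. With the same normalization, the same holds with the same limit if $M$ is drawn from the GUE. -/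

import Mathlib

open MeasureTheory ProbabilityTheory Filter Topology
open scoped Kronecker NNReal ENNReal

namespace OperatorSchmidt

/-! ### Pauli strings -/

/-- The computational basis of `n` qubits; it has `d = 2 ^ n` elements. -/
abbrev Qubits (n : ℕ) : Type := Fin n → Fin 2

/-- Pauli strings on `n` qubits; the letters `0, 1, 2, 3` stand for `I, X, Y, Z`. -/
abbrev PauliString (n : ℕ) : Type := Fin n → Fin 4

/-- The four single-qubit Pauli matrices `I, X, Y, Z`. -/
noncomputable def pauliMatrix : Fin 4 → Matrix (Fin 2) (Fin 2) ℂ :=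
  ![1, !![0, 1; 1, 0], !![0, -Complex.I; Complex.I, 0], !![1, 0; 0, -1]]

/-- The trace-normalized Pauli operator `2 ^ (-n / 2) • (σ_{s 1} ⊗ ⋯ ⊗ σ_{s n})`. -/
noncomputable def pauliOp {n : ℕ} (s : PauliString n) : Matrix (Qubits n) (Qubits n) ℂ :=
  fun a b => ((Real.sqrt 2 : ℂ) ^ n)⁻¹ * ∏ k, pauliMatrix (s k) (a k) (b k)

/-- The number of `Y` factors of a Pauli string. -/
def yCount {n : ℕ} (s : PauliString n) : ℕ := (Finset.univ.filter fun k => s k = 2).card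

/-- A Pauli string is real if it has an even number of `Y` factors. -/
abbrev IsRe {n : ℕ} (s : PauliString n) : Prop := Even (yCount s)

/-- A Pauli string is imaginary if it has an odd number of `Y` factors. -/
abbrev IsIm {n : ℕ} (s : PauliString n) : Prop := Odd (yCount s)

/-- The index set of the real Pauli strings on `n` qubits. -/
abbrev RePauli (n : ℕ) : Type := {s : PauliString n // IsRe s}

/-- The index set of the imaginary Pauli strings on `n` qubits. -/
abbrev ImPauli (n : ℕ) : Type := {s : PauliString n // IsIm s}

/-! ### The operator entanglement spectrum -/

/-- Operators on the bipartite space of `nA + nB` qubits, in the product basis. -/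
abbrev BiOp (nA nB : ℕ) (R : Type) : Type := Matrix (Qubits nA × Qubits nB) (Qubits nA × Qubits nB) R

/-- A real bipartite operator regarded as a complex one. -/
noncomputable def toComplexOp {nA nB : ℕ} (M : BiOp nA nB ℝ) : BiOp nA nB ℂ :=
  M.map Complex.ofReal

/-- The matrix of Pauli coefficients `α s t = tr ((P_s ⊗ P_t)† X)`. -/
noncomputable def pauliCoeff {nA nB : ℕ} (X : BiOp nA nB ℂ) :
    Matrix (PauliString nA) (PauliString nB) ℂ :=
  fun s t => Matrix.trace ((pauliOp s ⊗ₖ pauliOp t).conjTranspose * X)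

/-- The `d_A² × d_B²` matrix `X_{(α_A β_A)(α_B β_B)}` obtained from `X_{(α_A α_B)(β_A β_B)}` by
exchanging the indices `α_B` and `β_A`. -/
def partialTranspose {nA nB : ℕ} (X : BiOp nA nB ℂ) :
    Matrix (Qubits nA × Qubits nA) (Qubits nB × Qubits nB) ℂ :=
  fun a b => X (a.1, b.1) (a.2, b.2)

/-- The `d_B² × d_B²` Wishart matrix whose eigenvalues are the squared singular values of
`partialTranspose X`. -/
noncomputable def oesWishart {nA nB : ℕ} (X : BiOp nA nB ℂ) :
    Matrix (Qubits nB × Qubits nB) (Qubits nB × Qubits nB) ℂ :=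
  (partialTranspose X).conjTranspose * partialTranspose X

/-- The spectral distribution of the operator entanglement spectrum of `X`: the uniform measure
on the `d_B²` eigenvalues (with multiplicity) of `oesWishart X`. -/
noncomputable def oesDistribution {nA nB : ℕ} (X : BiOp nA nB ℂ) : Measure ℝ :=
  (Fintype.card (Qubits nB × Qubits nB) : ℝ≥0∞)⁻¹ •
    ∑ i, Measure.dirac
      ((Matrix.isHermitian_conjTranspose_mul_self (partialTranspose X)).eigenvalues i)

/-- The Frobenius norm `√(tr (X† X))`. -/
noncomputable def frobenius {nA nB : ℕ} (X : BiOp nA nB ℂ) : ℝ :=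
  Real.sqrt (Matrix.trace (X.conjTranspose * X)).re

/-- The operator `(d_B / ‖X‖_F) X`, whose entanglement spectrum has mean `1`. -/
noncomputable def normalizeOp {nA nB : ℕ} (X : BiOp nA nB ℂ) : BiOp nA nB ℂ :=
  (((2 : ℝ) ^ nB / frobenius X : ℝ) : ℂ) • X

/-! ### Random matrices -/

/-- The Borel (product) sigma-algebra on matrices. -/
instance instMeasurableSpaceMatrix {m n R : Type*} [MeasurableSpace R] :
    MeasurableSpace (Matrix m n R) :=
  inferInstanceAs (MeasurableSpace (m → n → R))

/-- The law of an `m × n` matrix with i.i.d. entries of law `μ`. -/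
noncomputable def iidMatrix (m n : Type*) [Fintype m] [Fintype n] {R : Type*} [MeasurableSpace R]
    (μ : Measure R) [SigmaFinite μ] : Measure (Matrix m n R) :=
  Measure.pi fun _ : m => Measure.pi fun _ : n => μ

/-- The standard complex Gaussian law: independent real and imaginary parts of variance `1 / 2`. -/
noncomputable def complexGaussian : Measure ℂ :=
  ((gaussianReal 0 (1 / 2)).prod (gaussianReal 0 (1 / 2))).map fun p : ℝ × ℝ => ⟨p.1, p.2⟩

instance : IsProbabilityMeasure complexGaussian :=
  Measure.isProbabilityMeasure_map
    (Complex.measurableEquivRealProd.symm.measurable.aemeasurable)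

/-- The Gaussian unitary ensemble: the law of `(G + G†) / √2`, where the entries of `G` are i.i.d.
standard complex Gaussian. -/
noncomputable def gue (ι : Type*) [Fintype ι] : Measure (Matrix ι ι ℂ) :=
  (iidMatrix ι ι complexGaussian).map fun G => ((Real.sqrt 2 : ℂ)⁻¹) • (G + G.conjTranspose)

/-- The Gaussian orthogonal ensemble: the law of the (entrywise) real part of a GUE matrix. -/
noncomputable def goe (ι : Type*) [Fintype ι] : Measure (Matrix ι ι ℝ) :=
  (gue ι).map fun M => M.map Complex.re

/-- The density of the Marchenko–Pastur law with parameter `γ`. -/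
noncomputable def mpDensity (γ x : ℝ) : ℝ :=
  (Set.Icc ((1 - Real.sqrt γ) ^ 2) ((1 + Real.sqrt γ) ^ 2)).indicator
    (fun x => Real.sqrt (((1 + Real.sqrt γ) ^ 2 - x) * (x - (1 - Real.sqrt γ) ^ 2)) /
      (2 * Real.pi * x * γ)) x

/-- The Marchenko–Pastur law with parameter `0 < γ ≤ 1`. -/
noncomputable def mpLaw (γ : ℝ) : Measure ℝ :=
  volume.withDensity fun x => ENNReal.ofReal (mpDensity γ x)

/-! ### The two blocks of a real operator -/

/-- The block `M_+` of the Pauli coefficients of `M`: rows and columns are real Pauli strings. -/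
noncomputable def plusBlock {nA nB : ℕ} (M : BiOp nA nB ℝ) : Matrix (RePauli nA) (RePauli nB) ℝ :=
  fun s t => (pauliCoeff (toComplexOp M) s.1 t.1).re

/-- The block `M_-` of the Pauli coefficients of `M`: rows and columns are imaginary Pauli
strings. -/
noncomputable def minusBlock {nA nB : ℕ} (M : BiOp nA nB ℝ) : Matrix (ImPauli nA) (ImPauli nB) ℝ :=
  fun s t => (pauliCoeff (toComplexOp M) s.1 t.1).re

/-- A block, placed at its rows and columns in a larger matrix that is zero elsewhere. -/
def zeroExtend {ι κ : Type*} {p : ι → Prop} {q : κ → Prop} [DecidablePred p] [DecidablePred q]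
    (B : Matrix {i // p i} {j // q j} ℝ) : Matrix ι κ ℝ :=
  fun i j => if h : p i ∧ q j then B ⟨i, h.1⟩ ⟨j, h.2⟩ else 0

end OperatorSchmidt

open OperatorSchmidt

/-! The normalized Pauli strings are an orthonormal Hermitian basis, so α(X) and the partial
transpose of X differ by unitary factors on the left and on the right, and the entanglement spectrum
of X is the spectrum of α(X)†α(X) (`charpoly_oesWishart`). The GUE is the standard Gaussian measure
on Hermitian matrices, hence α of a GUE matrix has i.i.d. standard real Gaussian entries
(`gue_map_pauliCoeff`). Entrywise conjugation multiplies P_s ⊗ P_t by one sign for each Y. Passing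
from a Hermitian matrix to its entrywise real part therefore kills the coefficients with s, t of
opposite type and keeps all others, which gives the two independent Gaussian blocks of the GOE
(`goe_map_blocks`, `pauliCoeff_toComplexOp`).

For the limit, let X be a Gaussian block with N rows and p columns, T = N t and R = (XᵀX + T)⁻¹. The
Sherman–Morrison formula turns p - T tr R into a sum over the rows of q/(1 + q), where q is the
quadratic form, at that row, of the resolvent with the row left out. The row is independent of that
resolvent, so q is close to its trace, and restoring the row changes the trace by at most 1/T. Hence
h = (N/p) tr R solves 1 - t h - h/(1 + (p/N) h) = 0 up to an error that vanishes in mean. The left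
side decreases in h with slope at most -t, so h converges to the solution for the ratio γ
(`tendsto_trace_wishartResolvent`), and an explicit integral identifies this solution as the
Stieltjes transform of the Marchenko–Pastur law at -t (`mpLaw_stieltjes`). Convergence of these
transforms for all t > 0 implies weak convergence (`tendsto_integral_of_tendsto_stieltjes`), because
the functions 1/(x + t) and the constants span a dense space of continuous functions on [0, ∞].

The normalization is random but harmless: by the law of large numbers the squared Frobenius norm is
asymptotic to its mean, so the spectrum is rescaled by a factor asymptotic to 1/N for either block
(`tendsto_scale`). Both GOE blocks have aspect ratio tending to γ and contain asymptotically half of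
the eigenvalues, so their union has the same limit as the single block of the GUE. -/

namespace OperatorSchmidt

/-! ### Linear images of Gaussian vectors and coordinates of GUE matrices -/

section Gaussian

variable {ι κ m n : Type*}

instance {R : Type*} [Countable m] [Countable n] [TopologicalSpace R] [MeasurableSpace R]
    [BorelSpace R] [SecondCountableTopology R] : BorelSpace (Matrix m n R) :=
  inferInstanceAs (BorelSpace (m → n → R))

theorem measurable_uncurry_matrix {R : Type*} [MeasurableSpace R] :
    Measurable (fun (X : Matrix m n R) (p : m × n) => X p.1 p.2) :=
  measurable_pi_lambda _ fun p => (measurable_pi_apply p.2).comp (measurable_pi_apply p.1)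

theorem measurable_curry_matrix {R : Type*} [MeasurableSpace R] :
    Measurable (fun (x : m × n → R) => (fun i j => x (i, j) : Matrix m n R)) :=
  measurable_pi_lambda _ fun i => measurable_pi_lambda _ fun j => measurable_pi_apply (i, j)

theorem measurable_gue_map :
    Measurable fun G : Matrix ι ι ℂ => ((Real.sqrt 2 : ℂ)⁻¹) • (G + G.conjTranspose) := by
  refine measurable_pi_lambda _ fun i => measurable_pi_lambda _ fun j => ?_
  have h (i j : ι) : Measurable fun G : Matrix ι ι ℂ => G i j :=
    (measurable_pi_apply j).comp (measurable_pi_apply i)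
  exact ((h i j).add (Complex.continuous_conj.measurable.comp (h j i))).const_mul _

variable [Fintype ι] [Fintype κ] [Fintype m] [Fintype n]

/-- A linear image of a centred Gaussian vector with i.i.d. entries is again standard if the rows
of the matrix are orthonormal after rescaling by the variance. -/
theorem map_mulVec_pi_gaussianReal [DecidableEq κ] (v : ℝ≥0) (V : Matrix κ ι ℝ)
    (hV : (v : ℝ) • (V * V.transpose) = 1) :
    (Measure.pi fun _ : ι => gaussianReal 0 v).map V.mulVec =
      Measure.pi fun _ : κ => gaussianReal 0 1 := by
  have hmeas : Measurable V.mulVec := by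
    refine measurable_pi_lambda _ fun k => ?_
    simp only [Matrix.mulVec, dotProduct]
    fun_prop
  have hinj : MeasurableEmbedding (WithLp.toLp 2 : (κ → ℝ) → EuclideanSpace ℝ κ) :=
    (MeasurableEquiv.toLp 2 (κ → ℝ)).measurableEmbedding
  have key : ((Measure.pi fun _ : ι => gaussianReal 0 v).map V.mulVec).map
      (WithLp.toLp 2 : (κ → ℝ) → EuclideanSpace ℝ κ) =
      (Measure.pi fun _ : κ => gaussianReal 0 1).map (WithLp.toLp 2) := by
    have : IsProbabilityMeasure ((Measure.pi fun _ : ι => gaussianReal 0 v).map V.mulVec) :=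
      Measure.isProbabilityMeasure_map hmeas.aemeasurable
    have := Measure.isProbabilityMeasure_map (μ := (Measure.pi fun _ : ι => gaussianReal 0 v).map
      V.mulVec) hinj.measurable.aemeasurable
    have := Measure.isProbabilityMeasure_map (μ := Measure.pi fun _ : κ => gaussianReal 0 1)
      hinj.measurable.aemeasurable
    apply Measure.ext_of_charFun (E := EuclideanSpace ℝ κ)
    ext t
    -- The characteristic function of `V x` at `t` is that of `x` at `Vᵀ t`, and `hV` gives `v |Vᵀ
    -- t|² = |t|²`, so the Gaussian exponents agree.
    have h1 : charFun (((Measure.pi fun _ : ι => gaussianReal 0 v).map V.mulVec).map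
        (WithLp.toLp 2 : (κ → ℝ) → EuclideanSpace ℝ κ)) t =
        charFun ((Measure.pi fun _ : ι => gaussianReal 0 v).map
          (WithLp.toLp 2 : (ι → ℝ) → EuclideanSpace ℝ ι))
          (WithLp.toLp 2 (V.transpose.mulVec (WithLp.ofLp t))) := by
      rw [charFun_apply, charFun_apply, integral_map (by fun_prop) (by fun_prop),
        integral_map (by fun_prop) (by fun_prop), integral_map (by fun_prop) (by fun_prop)]
      congr with x
      congr 3
      simp only [PiLp.inner_apply, RCLike.inner_apply, conj_trivial]
      change (WithLp.ofLp t) ⬝ᵥ V.mulVec x = (V.transpose.mulVec (WithLp.ofLp t)) ⬝ᵥ x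
      rw [Matrix.dotProduct_mulVec, Matrix.mulVec_transpose]
    have h2 : (v : ℝ) * ∑ i, (V.transpose.mulVec (WithLp.ofLp t) i) ^ 2 =
        ∑ k, (t k) ^ 2 := by
      have e1 : ∑ i, (V.transpose.mulVec (WithLp.ofLp t) i) ^ 2 =
          (WithLp.ofLp t) ⬝ᵥ ((V * V.transpose).mulVec (WithLp.ofLp t)) := by
        rw [← Matrix.mulVec_mulVec, Matrix.dotProduct_mulVec, ← Matrix.mulVec_transpose]
        simp only [dotProduct, sq]
      have e2 : ∑ k, (t k) ^ 2 = (WithLp.ofLp t) ⬝ᵥ (WithLp.ofLp t) := by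
        simp only [dotProduct, sq]
      rw [e1, e2, ← smul_eq_mul, ← dotProduct_smul, ← Matrix.smul_mulVec, hV, Matrix.one_mulVec]
    rw [h1, charFun_pi, charFun_pi]
    simp_rw [charFun_gaussianReal, ← Complex.exp_sum]
    congr 1
    have h3 := congrArg (fun x : ℝ => (x : ℂ)) h2
    push_cast at h3
    simp only [Complex.ofReal_zero, mul_zero, zero_mul, zero_sub, NNReal.coe_one,
      Complex.ofReal_one, one_mul, Finset.sum_neg_distrib, ← Finset.sum_div, ← Finset.mul_sum,
      ← h3]
  have := congrArg (fun μ => μ.map (WithLp.ofLp : EuclideanSpace ℝ κ → (κ → ℝ))) key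
  simp only at this
  rwa [Measure.map_map (by fun_prop) hinj.measurable, Measure.map_map (by fun_prop) hinj.measurable,
    show (WithLp.ofLp : EuclideanSpace ℝ κ → (κ → ℝ)) ∘ (WithLp.toLp 2) = id from rfl,
    Measure.map_id, Measure.map_id] at this

/-- Marginals of a standard Gaussian vector are standard Gaussian. -/
theorem map_comp_pi_gaussianReal (e : κ → ι) (he : Function.Injective e) :
    (Measure.pi fun _ : ι => gaussianReal 0 1).map (fun x => x ∘ e) =
      Measure.pi fun _ : κ => gaussianReal 0 1 := by
  classical
  -- The marginal is a linear image under a 0-1 selection matrix, whose rows are orthonormal because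
  -- `e` is injective.
  convert map_mulVec_pi_gaussianReal 1 (Matrix.of fun k i => if i = e k then (1 : ℝ) else 0) ?_
    using 2
  · ext x k
    simp [Matrix.mulVec, dotProduct]
  · ext k l
    simp [Matrix.mul_apply, Matrix.one_apply, he.eq_iff, eq_comm]

instance {R : Type*} [MeasurableSpace R] (μ : Measure R) [IsProbabilityMeasure μ] :
    IsProbabilityMeasure (iidMatrix m n μ) := by
  unfold iidMatrix; exact Measure.pi.instIsProbabilityMeasure _

theorem iidMatrix_rectangle {R : Type*} [MeasurableSpace R] (μ : Measure R)
    [IsProbabilityMeasure μ] (s : m → n → Set R) :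
    iidMatrix m n μ {X | ∀ i j, X i j ∈ s i j} = ∏ i, ∏ j, μ (s i j) := by
  have : {X : Matrix m n R | ∀ i j, X i j ∈ s i j} =
      Set.univ.pi fun i => Set.univ.pi fun j => s i j := by
    ext X; exact ⟨fun h i _ j _ => h i j, fun h i j => h i trivial j trivial⟩
  rw [this, iidMatrix]
  exact (Measure.pi_pi _ _).trans (Finset.prod_congr rfl fun i _ => Measure.pi_pi _ _)

theorem map_uncurry_iidMatrix {R : Type*} [MeasurableSpace R] (μ : Measure R)
    [IsProbabilityMeasure μ] :
    (iidMatrix m n μ).map (fun X (p : m × n) => X p.1 p.2) = Measure.pi fun _ => μ := by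
  refine (Measure.pi_eq fun s hs => ?_).symm
  rw [Measure.map_apply measurable_uncurry_matrix (MeasurableSet.univ_pi hs),
    Fintype.prod_prod_type, ← iidMatrix_rectangle]
  congr 1
  ext X
  simp [Set.mem_pi]

theorem map_curry_pi {R : Type*} [MeasurableSpace R] (μ : Measure R) [IsProbabilityMeasure μ] :
    (Measure.pi fun _ : m × n => μ).map (fun x => (fun i j => x (i, j) : Matrix m n R)) =
      iidMatrix m n μ := by
  rw [← map_uncurry_iidMatrix, Measure.map_map measurable_curry_matrix measurable_uncurry_matrix]
  exact Measure.map_id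

/-- The real and imaginary parts of a matrix with i.i.d. standard complex Gaussian entries are
independent real Gaussian variables of variance `1 / 2`. -/
theorem map_re_im_iidMatrix_complexGaussian :
    (iidMatrix m n complexGaussian).map
      (fun G => Sum.elim (fun p : m × n => (G p.1 p.2).re) (fun p : m × n => (G p.1 p.2).im)) =
      Measure.pi fun _ => gaussianReal 0 (1 / 2) := by
  refine (Measure.pi_eq fun s hs => ?_).symm
  have hm : Measurable (fun G : Matrix m n ℂ => Sum.elim (fun p : m × n => (G p.1 p.2).re)
      (fun p : m × n => (G p.1 p.2).im)) := by
    refine measurable_pi_lambda _ fun q => ?_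
    rcases q with p | p
    · exact Complex.measurable_re.comp ((measurable_pi_apply p).comp measurable_uncurry_matrix)
    · exact Complex.measurable_im.comp ((measurable_pi_apply p).comp measurable_uncurry_matrix)
  rw [Measure.map_apply hm (MeasurableSet.univ_pi hs), Fintype.prod_sum_type,
    ← Finset.prod_mul_distrib, Fintype.prod_prod_type]
  have h1 : ∀ a b : Set ℝ, MeasurableSet a → MeasurableSet b →
      complexGaussian (Complex.re ⁻¹' a ∩ Complex.im ⁻¹' b) =
        gaussianReal 0 (1 / 2) a * gaussianReal 0 (1 / 2) b := by
    intro a b ha hb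
    have hm : Measurable fun p : ℝ × ℝ => (⟨p.1, p.2⟩ : ℂ) :=
      Complex.measurableEquivRealProd.symm.measurable
    rw [complexGaussian, Measure.map_apply hm
      ((Complex.measurable_re ha).inter (Complex.measurable_im hb)), ← Measure.prod_prod]
    rfl
  simp_rw [fun p : m × n => (h1 _ _ (hs (Sum.inl p)) (hs (Sum.inr p))).symm]
  rw [← iidMatrix_rectangle]
  congr 1
  ext G
  simp [Set.mem_pi, forall_and]

instance : IsProbabilityMeasure (gue ι) :=
  Measure.isProbabilityMeasure_map measurable_gue_map.aemeasurable

/-- The coordinates of a GUE matrix with respect to orthonormal Hermitian matrices are i.i.d.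
standard Gaussian. -/
theorem gue_map_trace [DecidableEq κ] (A : κ → Matrix ι ι ℂ) (hA : ∀ k, (A k).IsHermitian)
    (hAA : ∀ k l, (Matrix.trace (A k * A l)).re = if k = l then 1 else 0) :
    (gue ι).map (fun M k => (Matrix.trace (A k * M)).re) =
      Measure.pi fun _ : κ => gaussianReal 0 1 := by
  have he (i j : ι) : Measurable fun G : Matrix ι ι ℂ => G i j :=
    (measurable_pi_apply j).comp (measurable_pi_apply i)
  -- For Hermitian `A` the coordinate of `(G + G†) / √2` is `√2 Re tr (A G)`; the rows of `V` are
  -- its coefficients on the real and imaginary parts of `G`. The variance `1 / 2` of these parts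
  -- compensates the square of `√2`.
  let V : Matrix κ ((ι × ι) ⊕ (ι × ι)) ℝ := fun k =>
    Sum.elim (fun p => Real.sqrt 2 * (A k p.2 p.1).re) (fun p => -Real.sqrt 2 * (A k p.2 p.1).im)
  have h2 : Real.sqrt 2 * Real.sqrt 2 = 2 := Real.mul_self_sqrt (by norm_num)
  have hV : ((1 / 2 : ℝ≥0) : ℝ) • (V * V.transpose) = 1 := by
    ext k l
    have := hAA k l
    have e : (Matrix.trace (A k * A l)).re =
        ∑ p : ι × ι, ((A k p.2 p.1).re * (A l p.2 p.1).re +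
          (A k p.2 p.1).im * (A l p.2 p.1).im) := by
      rw [Fintype.sum_prod_type_right, Matrix.trace, Complex.re_sum]
      refine Finset.sum_congr rfl fun i _ => ?_
      rw [Matrix.diag_apply, Matrix.mul_apply, Complex.re_sum]
      refine Finset.sum_congr rfl fun j _ => ?_
      rw [← (hA l).apply j i]
      simp [Complex.mul_re]
    rw [e] at this
    rw [Matrix.smul_apply, Matrix.mul_apply, Fintype.sum_sum_type, ← Finset.sum_add_distrib,
      Matrix.one_apply, ← this, Finset.smul_sum]
    refine Finset.sum_congr rfl fun p _ => ?_
    change ((1 / 2 : ℝ≥0) : ℝ) • (Real.sqrt 2 * (A k p.2 p.1).re * (Real.sqrt 2 * (A l p.2 p.1).re)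
      + -Real.sqrt 2 * (A k p.2 p.1).im * (-Real.sqrt 2 * (A l p.2 p.1).im)) = _
    rw [smul_eq_mul]
    push_cast
    linear_combination (1 / 2 * ((A k p.2 p.1).re * (A l p.2 p.1).re +
          (A k p.2 p.1).im * (A l p.2 p.1).im)) * h2
  rw [← map_mulVec_pi_gaussianReal (1 / 2) V hV, ← map_re_im_iidMatrix_complexGaussian,
    Measure.map_map, gue, Measure.map_map _ measurable_gue_map]
  · congr 1
    ext G k
    simp only [Function.comp_apply, Matrix.mulVec, dotProduct, Fintype.sum_sum_type, V,
      Sum.elim_inl, Sum.elim_inr]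
    have e1 : (Matrix.trace (A k * G.conjTranspose)).re = (Matrix.trace (A k * G)).re := by
      rw [← Complex.conj_re, ← Complex.star_def, ← Matrix.trace_conjTranspose,
        Matrix.conjTranspose_mul, Matrix.conjTranspose_conjTranspose, (hA k).eq,
        Matrix.trace_mul_comm]
    rw [Matrix.mul_smul, Matrix.trace_smul, Matrix.mul_add, Matrix.trace_add, smul_eq_mul,
      ← Complex.ofReal_inv, Complex.re_ofReal_mul, Complex.add_re, e1, ← Finset.sum_add_distrib]
    have e2 : (Matrix.trace (A k * G)).re =
        ∑ p : ι × ι, ((A k p.2 p.1).re * (G p.1 p.2).re -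
          (A k p.2 p.1).im * (G p.1 p.2).im) := by
      rw [Fintype.sum_prod_type_right, Matrix.trace, Complex.re_sum]
      refine Finset.sum_congr rfl fun i _ => ?_
      rw [Matrix.diag_apply, Matrix.mul_apply, Complex.re_sum]
      refine Finset.sum_congr rfl fun j _ => ?_
      simp [Complex.mul_re]
    have e3 : (Real.sqrt 2)⁻¹ * (2 : ℝ) = Real.sqrt 2 := by
      rw [inv_mul_eq_div, Real.div_sqrt]
    rw [← two_mul, ← mul_assoc, e3, e2, Finset.mul_sum]
    refine Finset.sum_congr rfl fun p _ => ?_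
    ring
  · refine measurable_pi_lambda _ fun k => ?_
    simp only [Matrix.trace, Matrix.diag_apply, Matrix.mul_apply]
    fun_prop
  · refine measurable_pi_lambda _ fun k => ?_
    simp only [Matrix.mulVec, dotProduct]
    fun_prop
  · refine measurable_pi_lambda _ fun q => ?_
    rcases q with p | p
    · exact Complex.measurable_re.comp (he _ _)
    · exact Complex.measurable_im.comp (he _ _)

end Gaussian

/-! ### Pauli operators: conjugation signs, orthonormality and counting -/

section Pauli

open Matrix

theorem star_pauliMatrix_swap (s : Fin 4) (a b : Fin 2) :
    star (pauliMatrix s b a) = pauliMatrix s a b := by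
  fin_cases s <;> fin_cases a <;> fin_cases b <;> simp [pauliMatrix]

theorem star_pauliMatrix (s : Fin 4) (a b : Fin 2) :
    star (pauliMatrix s a b) = (if s = 2 then -1 else 1) * pauliMatrix s a b := by
  fin_cases s <;> fin_cases a <;> fin_cases b <;> simp [pauliMatrix]

theorem sum_star_pauliMatrix_mul (s t : Fin 4) :
    ∑ a, ∑ b, star (pauliMatrix s a b) * pauliMatrix t a b = if s = t then 2 else 0 := by
  fin_cases s <;> fin_cases t <;> simp [pauliMatrix, Fin.sum_univ_two, one_add_one_eq_two]

theorem star_inv_sqrt_two_pow (n : ℕ) :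
    star ((Real.sqrt 2 : ℂ) ^ n)⁻¹ = ((Real.sqrt 2 : ℂ) ^ n)⁻¹ := by
  rw [← Complex.ofReal_pow, ← Complex.ofReal_inv, Complex.star_def, Complex.conj_ofReal]

variable {n : ℕ}

theorem isHermitian_pauliOp (s : PauliString n) : (pauliOp s).IsHermitian := by
  ext a b
  rw [conjTranspose_apply, pauliOp, star_mul', star_inv_sqrt_two_pow, star_prod]
  simp only [star_pauliMatrix_swap]
  rfl

/-- `Y` is the only letter with non-real entries, and they are purely imaginary, so each `Y`
contributes one sign. -/
theorem star_pauliOp (s : PauliString n) (a b : Qubits n) :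
    star (pauliOp s a b) = (-1) ^ yCount s * pauliOp s a b := by
  rw [pauliOp, star_mul', star_inv_sqrt_two_pow, star_prod]
  simp only [star_pauliMatrix, Finset.prod_mul_distrib]
  have : ∏ k, (if s k = 2 then (-1 : ℂ) else 1) = (-1) ^ yCount s := by
    rw [Finset.prod_ite, Finset.prod_const, Finset.prod_const_one, mul_one, yCount]
  rw [this]
  ring

/-- The double sum factorizes over the qubits, and each one-qubit sum is `2` or `0`; the
normalization cancels `2 ^ n`. -/
theorem sum_star_pauliOp_mul (s t : PauliString n) :
    ∑ p : Qubits n × Qubits n, star (pauliOp s p.1 p.2) * pauliOp t p.1 p.2 =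
      if s = t then 1 else 0 := by
  have h1 : ∀ a b : Qubits n, star (pauliOp s a b) * pauliOp t a b =
      ((2 : ℂ) ^ n)⁻¹ * ∏ k, (star (pauliMatrix (s k) (a k) (b k)) *
        pauliMatrix (t k) (a k) (b k)) := by
    intro a b
    have h2 : ((Real.sqrt 2 : ℂ) ^ n)⁻¹ * ((Real.sqrt 2 : ℂ) ^ n)⁻¹ = ((2 : ℂ) ^ n)⁻¹ := by
      rw [← mul_inv, ← mul_pow, ← Complex.ofReal_mul, Real.mul_self_sqrt (by norm_num)]
      norm_num
    rw [pauliOp, star_mul', star_inv_sqrt_two_pow, star_prod, Finset.prod_mul_distrib, ← h2,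
      pauliOp]
    ring
  have h3 : ∑ a : Qubits n, ∑ b : Qubits n, ∏ k, (star (pauliMatrix (s k) (a k) (b k)) *
      pauliMatrix (t k) (a k) (b k)) = ∏ k, (if s k = t k then (2 : ℂ) else 0) := by
    simp only [← sum_star_pauliMatrix_mul]
    rw [Finset.prod_univ_sum, Fintype.piFinset_univ]
    refine Finset.sum_congr rfl fun a _ => ?_
    rw [Finset.prod_univ_sum, Fintype.piFinset_univ]
  rw [Fintype.sum_prod_type]
  simp only [h1, ← Finset.mul_sum, h3]
  by_cases h : s = t
  · subst h
    simp
  · obtain ⟨k, hk⟩ := Function.ne_iff.1 h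
    rw [Finset.prod_eq_zero (Finset.mem_univ k) (if_neg hk), if_neg h, mul_zero]

theorem trace_pauliOp_mul (s t : PauliString n) :
    (pauliOp s * pauliOp t).trace = if s = t then 1 else 0 := by
  rw [← sum_star_pauliOp_mul, Fintype.sum_prod_type_right, Matrix.trace]
  refine Finset.sum_congr rfl fun a _ => ?_
  rw [diag_apply, mul_apply]
  refine Finset.sum_congr rfl fun b _ => ?_
  rw [(isHermitian_pauliOp s).apply]

/-- The unitary change of basis from matrix units to Pauli operators. -/
noncomputable def pauliBasisChange (n : ℕ) : Matrix (PauliString n) (Qubits n × Qubits n) ℂ :=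
  fun s p => star (pauliOp s p.1 p.2)

theorem card_pauliString_eq (n : ℕ) :
    Fintype.card (PauliString n) = Fintype.card (Qubits n × Qubits n) := by
  simp [← mul_pow]

theorem pauliBasisChange_mul_conjTranspose (n : ℕ) :
    pauliBasisChange n * (pauliBasisChange n)ᴴ = 1 := by
  ext s t
  rw [mul_apply, one_apply, ← sum_star_pauliOp_mul]
  simp [pauliBasisChange]

theorem conjTranspose_mul_pauliBasisChange (n : ℕ) :
    (pauliBasisChange n)ᴴ * pauliBasisChange n = 1 :=
  (mul_eq_one_comm_of_card_eq _ _ _ (card_pauliString_eq n)).1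
    (pauliBasisChange_mul_conjTranspose n)

/-- The sign is multiplicative in the letters, so the sum factorizes and each position contributes
`1 + 1 - 1 + 1 = 2`. -/
theorem sum_neg_one_pow_yCount (n : ℕ) : ∑ s : PauliString n, (-1 : ℤ) ^ yCount s = 2 ^ n := by
  have h : ∀ s : PauliString n, (-1 : ℤ) ^ yCount s = ∏ k, (if s k = 2 then (-1 : ℤ) else 1) := by
    intro s
    rw [Finset.prod_ite, Finset.prod_const, Finset.prod_const_one, mul_one, yCount]
  have h2 := Finset.prod_univ_sum (fun _ : Fin n => (Finset.univ : Finset (Fin 4)))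
    (fun _ j => if j = 2 then (-1 : ℤ) else 1)
  rw [Fintype.piFinset_univ] at h2
  simp only [h, ← h2, Fin.sum_univ_four]
  simp

/-- The two counts have sum `4 ^ n` and, by the signed count, difference `2 ^ n`. The doubled form
avoids division in `ℕ`. -/
theorem card_rePauli_imPauli (n : ℕ) :
    2 * Fintype.card (RePauli n) = 2 ^ n * (2 ^ n + 1) ∧
      2 * Fintype.card (ImPauli n) = 2 ^ n * (2 ^ n - 1) := by
  have hadd : Fintype.card (RePauli n) + Fintype.card (ImPauli n) = 2 ^ n * 2 ^ n := by
    rw [Fintype.card_subtype, Fintype.card_subtype, ← Finset.card_union_of_disjoint]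
    · have : Finset.univ.filter (fun s : PauliString n => IsRe s) ∪
          Finset.univ.filter (fun s : PauliString n => IsIm s) = Finset.univ := by
        ext s
        simpa using Nat.even_or_odd _
      rw [this, Finset.card_univ, card_pauliString_eq]
      simp
    · rw [Finset.disjoint_filter]
      exact fun s _ h1 h2 => Nat.not_even_iff_odd.2 h2 h1
  have hsub : (Fintype.card (RePauli n) : ℤ) - Fintype.card (ImPauli n) = 2 ^ n := by
    rw [← sum_neg_one_pow_yCount, ← Finset.sum_filter_add_sum_filter_not Finset.univ
      (fun s : PauliString n => IsRe s), Fintype.card_subtype, Fintype.card_subtype,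
      Finset.sum_congr rfl fun s hs => (Finset.mem_filter.1 hs).2.neg_one_pow,
      Finset.sum_congr (s₁ := Finset.univ.filter fun s : PauliString n => ¬IsRe s) rfl fun s hs =>
        (Nat.not_even_iff_odd.1 (Finset.mem_filter.1 hs).2).neg_one_pow]
    simp [sub_eq_add_neg]
  have h1 : 1 ≤ 2 ^ n := Nat.one_le_two_pow
  zify [h1] at hadd ⊢
  constructor <;> linarith

end Pauli

/-! ### Pauli coefficients as a unitary change of basis of the partial transpose -/

section Coefficients

open Matrix

variable {nA nB : ℕ}

theorem pauliCoeff_eq_trace (X : BiOp nA nB ℂ) (s : PauliString nA) (t : PauliString nB) :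
    pauliCoeff X s t = ((pauliOp s ⊗ₖ pauliOp t) * X).trace := by
  rw [pauliCoeff, conjTranspose_kronecker, isHermitian_pauliOp, isHermitian_pauliOp]

/-- Regrouping of the indices of a bipartite operator by subsystem. -/
def regroupEquiv {α β : Type*} : (α × β) × (α × β) ≃ (β × β) × (α × α) where
  toFun x := ((x.2.2, x.1.2), (x.2.1, x.1.1))
  invFun y := ((y.2.2, y.1.2), (y.2.1, y.1.1))

theorem pauliCoeff_apply (X : BiOp nA nB ℂ) (s : PauliString nA) (t : PauliString nB) :
    pauliCoeff X s t = ∑ q : Qubits nB × Qubits nB, ∑ p : Qubits nA × Qubits nA,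
      star (pauliOp s p.1 p.2) * star (pauliOp t q.1 q.2) * X (p.1, q.1) (p.2, q.2) := by
  rw [pauliCoeff, Matrix.trace]
  simp only [diag_apply, mul_apply, conjTranspose_apply]
  rw [← Fintype.sum_prod_type', ← Fintype.sum_prod_type']
  refine Fintype.sum_equiv regroupEquiv _ _ fun x => ?_
  rw [kronecker_apply, star_mul']
  rfl

theorem pauliCoeff_eq_mul (X : BiOp nA nB ℂ) :
    pauliCoeff X = pauliBasisChange nA * partialTranspose X * (pauliBasisChange nB)ᵀ := by
  ext s t
  rw [pauliCoeff_apply, mul_apply]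
  refine Finset.sum_congr rfl fun q _ => ?_
  rw [mul_apply, Finset.sum_mul]
  refine Finset.sum_congr rfl fun p _ => ?_
  simp only [pauliBasisChange, partialTranspose, transpose_apply]
  ring

theorem conjTranspose_pauliCoeff_mul (X : BiOp nA nB ℂ) :
    (pauliCoeff X)ᴴ * pauliCoeff X =
      ((pauliBasisChange nB)ᵀ)ᴴ * (oesWishart X * (pauliBasisChange nB)ᵀ) := by
  rw [pauliCoeff_eq_mul, conjTranspose_mul, conjTranspose_mul, oesWishart]
  simp only [Matrix.mul_assoc]
  rw [← Matrix.mul_assoc (pauliBasisChange nA)ᴴ, conjTranspose_mul_pauliBasisChange,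
    Matrix.one_mul]

theorem transpose_pauliBasisChange_mul (n : ℕ) :
    (pauliBasisChange n)ᵀ * ((pauliBasisChange n)ᵀ)ᴴ = 1 := by
  have h := congrArg Matrix.transpose (conjTranspose_mul_pauliBasisChange n)
  rw [transpose_mul, transpose_one] at h
  rw [← h]
  rfl

/-- The two Wishart matrices are unitarily equivalent, but over different index types. Comparing the
characteristic polynomials of `AB` and `BA` copes with this; the types have equal cardinality, so no
power of the variable appears. -/
theorem charpoly_oesWishart (X : BiOp nA nB ℂ) :
    (oesWishart X).charpoly = ((pauliCoeff X)ᴴ * pauliCoeff X).charpoly := by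
  have h := charpoly_mul_comm_of_le ((pauliBasisChange nB)ᵀ)ᴴ
    (oesWishart X * (pauliBasisChange nB)ᵀ) (card_pauliString_eq nB).symm.le
  rw [conjTranspose_pauliCoeff_mul]
  rw [card_pauliString_eq, Nat.sub_self, pow_zero, one_mul, Matrix.mul_assoc,
    transpose_pauliBasisChange_mul, Matrix.mul_one] at h
  exact h.symm

theorem trace_oesWishart (X : BiOp nA nB ℂ) :
    (oesWishart X).trace = ((pauliCoeff X)ᴴ * pauliCoeff X).trace := by
  rw [conjTranspose_pauliCoeff_mul, trace_mul_comm, Matrix.mul_assoc,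
    transpose_pauliBasisChange_mul, Matrix.mul_one]

/-- Both sides add up the squared moduli of all entries, which the partial transposition only
rearranges. -/
theorem trace_conjTranspose_mul_self_eq (X : BiOp nA nB ℂ) :
    (Xᴴ * X).trace = (oesWishart X).trace := by
  simp only [oesWishart, Matrix.trace, diag_apply, mul_apply, conjTranspose_apply,
    partialTranspose]
  rw [← Fintype.sum_prod_type', ← Fintype.sum_prod_type']
  exact Fintype.sum_equiv regroupEquiv _ _ fun _ => rfl

theorem star_pauliCoeff_of_isHermitian {X : BiOp nA nB ℂ} (hX : X.IsHermitian)
    (s : PauliString nA) (t : PauliString nB) : star (pauliCoeff X s t) = pauliCoeff X s t := by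
  rw [pauliCoeff_eq_trace, ← trace_conjTranspose, conjTranspose_mul, conjTranspose_kronecker,
    isHermitian_pauliOp, isHermitian_pauliOp, hX.eq, trace_mul_comm]

/-- A real operator is fixed by entrywise conjugation, so the sign comes from the Pauli operators
alone. Together with the reality of the coefficients of a Hermitian operator, this makes the mixed
coefficients vanish. -/
theorem star_pauliCoeff_toComplexOp (M : BiOp nA nB ℝ)
    (s : PauliString nA) (t : PauliString nB) :
    star (pauliCoeff (toComplexOp M) s t) =
      (-1) ^ (yCount s + yCount t) * pauliCoeff (toComplexOp M) s t := by
  rw [pauliCoeff_apply, star_sum, Finset.mul_sum]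
  refine Finset.sum_congr rfl fun q _ => ?_
  rw [star_sum, Finset.mul_sum]
  refine Finset.sum_congr rfl fun p _ => ?_
  have h : star (toComplexOp M (p.1, q.1) (p.2, q.2)) = toComplexOp M (p.1, q.1) (p.2, q.2) := by
    simp [toComplexOp]
  rw [star_mul', star_mul', h, star_pauliOp, star_pauliOp, star_mul', star_mul', star_pauliOp,
    star_pauliOp, pow_add]
  have h1 : ∀ k : ℕ, star ((-1 : ℂ) ^ k) = (-1) ^ k := fun k => by simp
  rw [h1, h1]
  ring

/-- Taking the real part of an operator does not change the real part of the coefficients on Pauli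
strings with an even total number of `Y` factors. -/
theorem re_pauliCoeff_map_re (X : BiOp nA nB ℂ) {s : PauliString nA} {t : PauliString nB}
    (h : Even (yCount s + yCount t)) :
    (pauliCoeff (toComplexOp (X.map Complex.re)) s t).re = (pauliCoeff X s t).re := by
  rw [pauliCoeff_apply, pauliCoeff_apply, Complex.re_sum, Complex.re_sum]
  refine Finset.sum_congr rfl fun q _ => ?_
  rw [Complex.re_sum, Complex.re_sum]
  refine Finset.sum_congr rfl fun p _ => ?_
  -- An even total number of `Y` factors makes the product of the Pauli entries real, so the
  -- imaginary part of `X` does not contribute.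
  have him : (star (pauliOp s p.1 p.2) * star (pauliOp t q.1 q.2)).im = 0 := by
    rw [← Complex.conj_eq_iff_im, ← Complex.star_def, star_mul', star_pauliOp, star_pauliOp,
      star_mul', star_mul', star_pauliOp, star_pauliOp]
    have h1 : ∀ k : ℕ, star ((-1 : ℂ) ^ k) = (-1) ^ k := fun k => by simp
    rw [h1, h1]
    have h2 := h.neg_one_pow (α := ℂ)
    rw [pow_add] at h2
    linear_combination ((-1) ^ yCount s * pauliOp s p.1 p.2 * (-1) ^ yCount t *
      pauliOp t q.1 q.2) * h2
  rw [Complex.mul_re (_ * _) (toComplexOp _ _ _), Complex.mul_re (_ * _) (X _ _), him]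
  simp only [toComplexOp, map_apply, Complex.ofReal_re, zero_mul]

end Coefficients

/-! ### Block structure of the coefficients of a real symmetric operator -/

section Blocks

open Matrix

/-- Real and imaginary Pauli strings partition all Pauli strings. -/
def pauliSumEquiv (n : ℕ) : RePauli n ⊕ ImPauli n ≃ PauliString n :=
  (Equiv.sumCongr (Equiv.refl _)
    (Equiv.subtypeEquivRight fun _ => Nat.not_even_iff_odd.symm)).trans
    (Equiv.sumCompl fun s : PauliString n => IsRe s)

@[simp]
theorem pauliSumEquiv_inl {n : ℕ} (s : RePauli n) : pauliSumEquiv n (Sum.inl s) = s.1 := rfl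

@[simp]
theorem pauliSumEquiv_inr {n : ℕ} (s : ImPauli n) : pauliSumEquiv n (Sum.inr s) = s.1 := rfl

variable {nA nB nC : ℕ}

theorem zeroExtend_apply {ι κ : Type*} {p : ι → Prop} {q : κ → Prop} [DecidablePred p]
    [DecidablePred q] (B : Matrix {i // p i} {j // q j} ℝ) (i : {i // p i}) (j : {j // q j}) :
    zeroExtend B i.1 j.1 = B i j :=
  dif_pos ⟨i.2, j.2⟩

theorem zeroExtend_eq_zero {ι κ : Type*} {p : ι → Prop} {q : κ → Prop} [DecidablePred p]
    [DecidablePred q] (B : Matrix {i // p i} {j // q j} ℝ) {i : ι} {j : κ} (h : ¬(p i ∧ q j)) :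
    zeroExtend B i j = 0 :=
  dif_neg h

/-- The block diagonal form gives access to the rules for products, characteristic polynomials and
traces of block matrices. -/
theorem zeroExtend_add (B : Matrix (RePauli nA) (RePauli nB) ℝ)
    (C : Matrix (ImPauli nA) (ImPauli nB) ℝ) :
    (zeroExtend B + zeroExtend C : Matrix (PauliString nA) (PauliString nB) ℝ) =
      (fromBlocks B 0 0 C).submatrix (pauliSumEquiv nA).symm (pauliSumEquiv nB).symm := by
  ext s t
  obtain ⟨s, rfl⟩ := (pauliSumEquiv nA).surjective s
  obtain ⟨t, rfl⟩ := (pauliSumEquiv nB).surjective t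
  rw [submatrix_apply, Equiv.symm_apply_apply, Equiv.symm_apply_apply, Matrix.add_apply]
  rcases s with s | s <;> rcases t with t | t <;>
    simp only [pauliSumEquiv_inl, pauliSumEquiv_inr]
  · rw [zeroExtend_apply B s t, zeroExtend_eq_zero C fun h => Nat.not_even_iff_odd.2 h.1 s.2,
      add_zero]
    rfl
  · rw [zeroExtend_eq_zero B fun h => Nat.not_even_iff_odd.2 t.2 h.2,
      zeroExtend_eq_zero C fun h => Nat.not_even_iff_odd.2 h.1 s.2, add_zero]
    rfl
  · rw [zeroExtend_eq_zero B fun h => Nat.not_even_iff_odd.2 s.2 h.1,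
      zeroExtend_eq_zero C fun h => Nat.not_even_iff_odd.2 h.2 t.2, add_zero]
    rfl
  · rw [zeroExtend_eq_zero B fun h => Nat.not_even_iff_odd.2 s.2 h.1]
    exact (zero_add _).trans (zeroExtend_apply C s t)

theorem transpose_mul_zeroExtend_add (B : Matrix (RePauli nA) (RePauli nB) ℝ)
    (C : Matrix (ImPauli nA) (ImPauli nB) ℝ) :
    (zeroExtend B + zeroExtend C : Matrix (PauliString nA) (PauliString nB) ℝ)ᵀ *
      (zeroExtend B + zeroExtend C : Matrix (PauliString nA) (PauliString nB) ℝ) =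
      zeroExtend (Bᵀ * B) + zeroExtend (Cᵀ * C) := by
  rw [zeroExtend_add, zeroExtend_add, transpose_submatrix, submatrix_mul_equiv,
    fromBlocks_transpose, fromBlocks_multiply]
  simp

theorem charpoly_zeroExtend_add (B : Matrix (RePauli nA) (RePauli nA) ℝ)
    (C : Matrix (ImPauli nA) (ImPauli nA) ℝ) :
    (zeroExtend B + zeroExtend C : Matrix (PauliString nA) (PauliString nA) ℝ).charpoly =
      B.charpoly * C.charpoly := by
  rw [zeroExtend_add]
  exact (charpoly_reindex (pauliSumEquiv nA) _).trans (charpoly_fromBlocks_zero₁₂ ..)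

theorem conjTranspose_map_ofReal_mul {ι κ : Type*} [Fintype ι] (A : Matrix ι κ ℝ) :
    (A.map Complex.ofReal)ᴴ * A.map Complex.ofReal = (Aᵀ * A).map Complex.ofReal := by
  ext i j
  simp [mul_apply]

/-- The block structure of the Pauli coefficients of a real symmetric operator. -/
theorem pauliCoeff_toComplexOp {M : BiOp nA nB ℝ} (hM : M.IsSymm) :
    pauliCoeff (toComplexOp M) =
      (zeroExtend (plusBlock M) + zeroExtend (minusBlock M)).map Complex.ofReal := by
  have hH : (toComplexOp M).IsHermitian := by
    ext i j
    simp [toComplexOp, hM.apply]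
  have hreal : ∀ s t, ((pauliCoeff (toComplexOp M) s t).re : ℂ) = pauliCoeff (toComplexOp M) s t :=
    fun s t => Complex.conj_eq_iff_re.1 (star_pauliCoeff_of_isHermitian hH s t)
  have hzero : ∀ s t, ¬Even (yCount s + yCount t) → pauliCoeff (toComplexOp M) s t = 0 := by
    intro s t h
    have h1 := star_pauliCoeff_toComplexOp M s t
    rw [star_pauliCoeff_of_isHermitian hH, (Nat.not_even_iff_odd.1 h).neg_one_pow,
      neg_one_mul] at h1
    exact self_eq_neg.1 h1
  rw [zeroExtend_add]
  ext s t
  obtain ⟨s, rfl⟩ := (pauliSumEquiv nA).surjective s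
  obtain ⟨t, rfl⟩ := (pauliSumEquiv nB).surjective t
  rw [map_apply, submatrix_apply, Equiv.symm_apply_apply, Equiv.symm_apply_apply]
  rcases s with s | s <;> rcases t with t | t
  · exact (hreal s.1 t.1).symm
  · refine (hzero s.1 t.1 ?_).trans (by simp)
    simp [Nat.even_add, s.2, t.2]
  · refine (hzero s.1 t.1 ?_).trans (by simp)
    simp [Nat.even_add, s.2, t.2]
  · exact (hreal s.1 t.1).symm

theorem conjTranspose_pauliCoeff_mul_toComplexOp {M : BiOp nA nB ℝ} (hM : M.IsSymm) :
    (pauliCoeff (toComplexOp M))ᴴ * pauliCoeff (toComplexOp M) =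
      (zeroExtend ((plusBlock M)ᵀ * plusBlock M) +
        zeroExtend ((minusBlock M)ᵀ * minusBlock M)).map Complex.ofReal := by
  rw [pauliCoeff_toComplexOp hM, conjTranspose_map_ofReal_mul, transpose_mul_zeroExtend_add]

theorem charpoly_oesWishart_toComplexOp {M : BiOp nA nB ℝ} (hM : M.IsSymm) :
    (oesWishart (toComplexOp M)).charpoly =
      (((plusBlock M)ᵀ * plusBlock M).charpoly *
        ((minusBlock M)ᵀ * minusBlock M).charpoly).map Complex.ofRealHom := by
  rw [charpoly_oesWishart, conjTranspose_pauliCoeff_mul_toComplexOp hM, ← charpoly_zeroExtend_add,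
    ← charpoly_map]
  rfl

end Blocks

/-! ### Total mass and Stieltjes transform of the Marchenko–Pastur law -/

section MarchenkoPastur

/-- The arctangent is `-arg (1 - s e^{iθ})`, and the derivative is the Poisson kernel of the disc at
radius `s`. -/
theorem hasDerivAt_poisson {s : ℝ} (hs0 : 0 < s) (hs : s < 1) (θ : ℝ) :
    HasDerivAt (fun θ => θ + 2 * Real.arctan (s * Real.sin θ / (1 - s * Real.cos θ)))
      ((1 - s ^ 2) / (1 + s ^ 2 - 2 * s * Real.cos θ)) θ := by
  have hc := Real.cos_le_one θ
  have h1 : 0 < 1 - s * Real.cos θ := by nlinarith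
  have hD : 0 < 1 + s ^ 2 - 2 * s * Real.cos θ := by nlinarith [sq_nonneg (1 - s)]
  have hnum : HasDerivAt (fun θ => s * Real.sin θ) (s * Real.cos θ) θ :=
    (Real.hasDerivAt_sin θ).const_mul s
  have hden : HasDerivAt (fun θ => 1 - s * Real.cos θ) (-(s * -Real.sin θ)) θ :=
    ((Real.hasDerivAt_cos θ).const_mul s).const_sub 1
  have h := (hasDerivAt_id θ).add (((hnum.div hden h1.ne').arctan).const_mul 2)
  refine h.congr_deriv ?_
  have hsc : Real.sin θ ^ 2 = 1 - Real.cos θ ^ 2 := by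
    linarith [Real.sin_sq_add_cos_sq θ]
  have e1 : 1 + (s * Real.sin θ / (1 - s * Real.cos θ)) ^ 2 =
      (1 + s ^ 2 - 2 * s * Real.cos θ) / (1 - s * Real.cos θ) ^ 2 := by
    field_simp
    rw [hsc]; ring
  simp only [Pi.div_apply, e1]
  obtain ⟨D, hDdef⟩ : ∃ D, D = 1 + s ^ 2 - 2 * s * Real.cos θ := ⟨_, rfl⟩
  rw [← hDdef] at hD ⊢
  field_simp
  rw [hsc, hDdef]
  ring

/-- Dividing `sin² θ` by the denominator leaves a constant, a multiple of `cos θ` and a multiple of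
the Poisson kernel. Since the value does not depend on `s`, the same formula yields both the total
mass and the Stieltjes transform. -/
theorem integral_sin_sq_div {s : ℝ} (hs0 : 0 < s) (hs : s ≤ 1) :
    IntervalIntegrable (fun θ => Real.sin θ ^ 2 / (1 + s ^ 2 - 2 * s * Real.cos θ)) volume
      0 Real.pi ∧
      ∫ θ in (0 : ℝ)..Real.pi, Real.sin θ ^ 2 / (1 + s ^ 2 - 2 * s * Real.cos θ) =
        Real.pi / 2 := by
  have hpi := Real.pi_pos
  have hD : ∀ θ ∈ Set.Ioo 0 Real.pi, 0 < 1 + s ^ 2 - 2 * s * Real.cos θ := by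
    intro θ hθ
    have : Real.cos θ < 1 := by
      rw [← Real.cos_zero]
      exact Real.cos_lt_cos_of_nonneg_of_le_pi le_rfl hθ.2.le hθ.1
    nlinarith [sq_nonneg (1 - s)]
  obtain ⟨F, hFc, hFd, hF0, hFpi⟩ : ∃ F : ℝ → ℝ, ContinuousOn F (Set.Icc 0 Real.pi) ∧
      (∀ θ ∈ Set.Ioo 0 Real.pi, HasDerivAt F
        (Real.sin θ ^ 2 / (1 + s ^ 2 - 2 * s * Real.cos θ)) θ) ∧ F 0 = 0 ∧
      F Real.pi = Real.pi / 2 := by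
    rcases hs.lt_or_eq with hlt | rfl
    · have hder : ∀ θ, HasDerivAt (fun θ => -(1 - s ^ 2) / (4 * s ^ 2) *
          (θ + 2 * Real.arctan (s * Real.sin θ / (1 - s * Real.cos θ))) +
          (1 + s ^ 2) / (4 * s ^ 2) * θ + (2 * s)⁻¹ * Real.sin θ)
          (-(1 - s ^ 2) / (4 * s ^ 2) * ((1 - s ^ 2) / (1 + s ^ 2 - 2 * s * Real.cos θ)) +
          (1 + s ^ 2) / (4 * s ^ 2) * 1 + (2 * s)⁻¹ * Real.cos θ) θ := fun θ =>
        (((hasDerivAt_poisson hs0 hlt θ).const_mul _).add ((hasDerivAt_id θ).const_mul _)).add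
          ((Real.hasDerivAt_sin θ).const_mul _)
      refine ⟨_, fun θ _ => (hder θ).continuousAt.continuousWithinAt, fun θ hθ =>
        (hder θ).congr_deriv ?_, by simp, ?_⟩
      · have := hD θ hθ
        have hsc : Real.sin θ ^ 2 = 1 - Real.cos θ ^ 2 := by
          linarith [Real.sin_sq_add_cos_sq θ]
        obtain ⟨D, hDdef⟩ : ∃ D, D = 1 + s ^ 2 - 2 * s * Real.cos θ := ⟨_, rfl⟩
        rw [hsc, ← hDdef]
        rw [← hDdef] at this
        have hcos : Real.cos θ = (1 + s ^ 2 - D) / (2 * s) := by rw [hDdef]; field_simp; ring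
        rw [hcos]
        field_simp
        ring
      · simp
        field_simp
        ring
    -- At `s = 1` the denominator vanishes at `θ = 0`, but elsewhere in the interval the quotient is
    -- `(1 + cos θ) / 2`.
    · refine ⟨fun θ => θ / 2 + Real.sin θ / 2, by fun_prop, fun θ hθ => ?_, by simp, by simp⟩
      have h := ((hasDerivAt_id θ).div_const 2).add ((Real.hasDerivAt_sin θ).div_const 2)
      refine h.congr_deriv ?_
      have := hD θ hθ
      have hsc : Real.sin θ ^ 2 = 1 - Real.cos θ ^ 2 := by
        linarith [Real.sin_sq_add_cos_sq θ]
      rw [hsc, eq_div_iff this.ne']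
      ring
  -- The integrand is the nonnegative derivative of a function continuous up to the end points, so
  -- no bound near `θ = 0` is needed.
  have hint : IntervalIntegrable
      (fun θ => Real.sin θ ^ 2 / (1 + s ^ 2 - 2 * s * Real.cos θ)) volume 0 Real.pi := by
    refine intervalIntegral.intervalIntegrable_deriv_of_nonneg (g := F) ?_ ?_ ?_
    · rwa [Set.uIcc_of_le hpi.le]
    · rwa [min_eq_left hpi.le, max_eq_right hpi.le]
    · rw [min_eq_left hpi.le, max_eq_right hpi.le]
      intro θ hθ
      exact div_nonneg (sq_nonneg _) (hD θ hθ).le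
  refine ⟨hint, ?_⟩
  rw [intervalIntegral.integral_eq_sub_of_hasDerivAt_of_le hpi.le hFc hFd hint, hF0, hFpi, sub_zero]

theorem mpDensity_nonneg {γ : ℝ} (hγ : 0 < γ) (x : ℝ) : 0 ≤ mpDensity γ x := by
  refine Set.indicator_nonneg (fun y hy => ?_) x
  have : 0 ≤ y := (sq_nonneg _).trans hy.1
  have := Real.pi_pos
  positivity

theorem measurable_mpDensity (γ : ℝ) : Measurable (mpDensity γ) := by
  unfold mpDensity
  exact Measurable.indicator (by fun_prop) measurableSet_Icc

/-- Integrals against the Marchenko–Pastur law after the substitution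
`x = 1 + γ - 2 √γ cos θ`. -/
theorem integral_mul_mpDensity {γ : ℝ} (hγ : 0 < γ) (φ : ℝ → ℝ) :
    ∫ x, mpDensity γ x * φ x = ∫ θ in (0 : ℝ)..Real.pi, (2 / Real.pi) *
      (Real.sin θ ^ 2 / (1 + γ - 2 * Real.sqrt γ * Real.cos θ) *
        φ (1 + γ - 2 * Real.sqrt γ * Real.cos θ)) := by
  set r := Real.sqrt γ with hr
  have hr0 : 0 < r := Real.sqrt_pos.2 hγ
  have hrr : r ^ 2 = γ := Real.sq_sqrt hγ.le
  have hpi := Real.pi_pos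
  set G : ℝ → ℝ := fun x => Real.sqrt (((1 + r) ^ 2 - x) * (x - (1 - r) ^ 2)) /
      (2 * Real.pi * x * γ) with hG
  have h1 : (fun x => mpDensity γ x * φ x) =
      (Set.Icc ((1 - r) ^ 2) ((1 + r) ^ 2)).indicator fun x => G x * φ x := by
    ext x
    simp only [mpDensity, ← hr]
    rw [Set.indicator_mul_left]
  have hle : (1 - r) ^ 2 ≤ (1 + r) ^ 2 := by nlinarith
  rw [h1, integral_indicator measurableSet_Icc, integral_Icc_eq_integral_Ioc,
    ← intervalIntegral.integral_of_le hle]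
  have hcv := intervalIntegral.integral_comp_mul_deriv_of_deriv_nonneg (a := 0) (b := Real.pi)
    (f := fun θ => 1 + γ - 2 * r * Real.cos θ) (f' := fun θ => 2 * r * Real.sin θ)
    (g := fun x => G x * φ x) (by fun_prop) (fun θ _ => by
      have := ((Real.hasDerivAt_cos θ).const_mul (2 * r)).const_sub (1 + γ)
      exact this.congr_deriv (by ring)) (fun θ hθ => by
      rw [min_eq_left hpi.le, max_eq_right hpi.le] at hθ
      have := Real.sin_nonneg_of_mem_Icc ⟨hθ.1.le, hθ.2.le⟩
      positivity)
  have ea : 1 + γ - 2 * r * Real.cos 0 = (1 - r) ^ 2 := by rw [Real.cos_zero, ← hrr]; ring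
  have eb : 1 + γ - 2 * r * Real.cos Real.pi = (1 + r) ^ 2 := by rw [Real.cos_pi, ← hrr]; ring
  simp only [ea, eb] at hcv
  rw [← hcv]
  refine intervalIntegral.integral_congr fun θ hθ => ?_
  rw [Set.uIcc_of_le hpi.le] at hθ
  have hsin := Real.sin_nonneg_of_mem_Icc hθ
  have hsc : Real.sin θ ^ 2 = 1 - Real.cos θ ^ 2 := by linarith [Real.sin_sq_add_cos_sq θ]
  have hsq : ((1 + r) ^ 2 - (1 + γ - 2 * r * Real.cos θ)) *
      ((1 + γ - 2 * r * Real.cos θ) - (1 - r) ^ 2) = (2 * r * Real.sin θ) ^ 2 := by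
    rw [mul_pow, hsc, ← hrr]; ring
  simp only [Function.comp_apply, hG, hsq, Real.sqrt_sq (by positivity : 0 ≤ 2 * r * Real.sin θ)]
  rw [← hrr]
  -- This occurs only for `γ = 1` at `θ = 0`, where both sides are zero because division by zero
  -- gives zero.
  by_cases hx : 1 + r ^ 2 - 2 * r * Real.cos θ = 0
  · simp [hx]
  · field_simp

theorem integral_mpDensity {γ : ℝ} (hγ : 0 < γ) (hγ1 : γ ≤ 1) : ∫ x, mpDensity γ x = 1 := by
  have h := integral_mul_mpDensity hγ fun _ => 1
  simp only [mul_one] at h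
  have hJ := (integral_sin_sq_div (Real.sqrt_pos.2 hγ) (Real.sqrt_le_one.2 hγ1)).2
  rw [Real.sq_sqrt hγ.le] at hJ
  rw [h, intervalIntegral.integral_const_mul, hJ]
  field_simp

theorem isProbabilityMeasure_mpLaw {γ : ℝ} (hγ : 0 < γ) (hγ1 : γ ≤ 1) :
    IsProbabilityMeasure (mpLaw γ) := by
  have hint : Integrable (mpDensity γ) := by
    -- The integral of a non-integrable function is zero by convention, whereas this one is `1`.
    by_contra h
    have := integral_mpDensity hγ hγ1
    rw [integral_undef h] at this
    exact zero_ne_one this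
  refine ⟨?_⟩
  rw [mpLaw, withDensity_apply _ MeasurableSet.univ, Measure.restrict_univ,
    ← ofReal_integral_eq_lintegral_ofReal hint (Eventually.of_forall (mpDensity_nonneg hγ)),
    integral_mpDensity hγ hγ1, ENNReal.ofReal_one]

theorem mpLaw_nonneg (γ : ℝ) : ∀ᵐ x ∂(mpLaw γ), 0 ≤ x := by
  rw [mpLaw, ae_withDensity_iff (measurable_mpDensity γ).ennreal_ofReal]
  refine Eventually.of_forall fun x hx => ?_
  by_contra h
  refine hx ?_
  have : x ∉ Set.Icc ((1 - Real.sqrt γ) ^ 2) ((1 + Real.sqrt γ) ^ 2) := fun hx' =>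
    h ((sq_nonneg _).trans hx'.1)
  rw [mpDensity, Set.indicator_of_notMem this, ENNReal.ofReal_zero]

/-- The Stieltjes transform of the Marchenko–Pastur law on the negative half-axis solves the
self-consistent equation. -/
theorem mpLaw_stieltjes {γ : ℝ} (hγ : 0 < γ) (hγ1 : γ ≤ 1) {t : ℝ} (ht : 0 < t) :
    0 ≤ ∫ x, (x + t)⁻¹ ∂(mpLaw γ) ∧
    1 - t * (∫ x, (x + t)⁻¹ ∂(mpLaw γ)) -
      (∫ x, (x + t)⁻¹ ∂(mpLaw γ)) / (1 + γ * ∫ x, (x + t)⁻¹ ∂(mpLaw γ)) = 0 ∧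
    1 - t * (∫ x, (x + t)⁻¹ ∂(mpLaw γ)) ≤ (1 + t)⁻¹ := by
  set r := Real.sqrt γ with hr
  have hr0 : 0 < r := Real.sqrt_pos.2 hγ
  have hrr : r ^ 2 = γ := Real.sq_sqrt hγ.le
  have hr1 : r ≤ 1 := Real.sqrt_le_one.2 hγ1
  have hpi := Real.pi_pos
  set b := 1 + γ + t with hb
  have hdisc : 0 ≤ b ^ 2 - 4 * γ := by rw [hb]; nlinarith [sq_nonneg (1 - γ)]
  -- `κ` is the larger root of `κ² - b κ + γ = 0`. For `x = 1 + γ - 2 r cos θ` this makes `x + t = κ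
  -- (1 + (r/κ)² - 2 (r/κ) cos θ)`, so partial fractions reduce the transform to
  -- `integral_sin_sq_div` at `s = r` and at `s = r/κ`. The outcome `g` satisfies `1 - t g = 1/κ`.
  set κ := (b + Real.sqrt (b ^ 2 - 4 * γ)) / 2 with hκ
  have hκb : b / 2 ≤ κ := by rw [hκ]; linarith [Real.sqrt_nonneg (b ^ 2 - 4 * γ)]
  have hκeq : κ ^ 2 + γ = b * κ := by
    rw [hκ]; nlinarith [Real.sq_sqrt hdisc]
  have hκγ : γ < κ := by rw [hb] at hκb; linarith
  have hκ0 : 0 < κ := hγ.trans hκγ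
  have hprod : (κ - 1) * (κ - γ) = t * κ := by rw [hb] at hκeq; linear_combination hκeq
  have hκ1 : 1 < κ := by
    by_contra h
    have : (κ - 1) * (κ - γ) ≤ 0 := mul_nonpos_of_nonpos_of_nonneg (by linarith) (by linarith)
    nlinarith [mul_pos ht hκ0]
  have hκt : 1 + t ≤ κ := by rw [hb] at hκeq; nlinarith
  have hs0 : 0 < r / κ := by positivity
  have hs1 : r / κ ≤ 1 := by
    rw [div_le_one hκ0]; nlinarith [sq_nonneg (1 - r)]
  obtain ⟨hI0, hJ0⟩ := integral_sin_sq_div hr0 hr1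
  obtain ⟨hI1, hJ1⟩ := integral_sin_sq_div hs0 hs1
  rw [hrr] at hI0 hJ0
  have hg : ∫ x, (x + t)⁻¹ ∂(mpLaw γ) = (1 - κ⁻¹) / t := by
    rw [mpLaw, integral_withDensity_eq_integral_toReal_smul
      (measurable_mpDensity γ).ennreal_ofReal (Eventually.of_forall fun _ => ENNReal.ofReal_lt_top)]
    simp only [ENNReal.toReal_ofReal (mpDensity_nonneg hγ _), smul_eq_mul]
    rw [integral_mul_mpDensity hγ fun x => (x + t)⁻¹, intervalIntegral.integral_const_mul, ← hr]
    have : ∫ θ in (0 : ℝ)..Real.pi, Real.sin θ ^ 2 / (1 + γ - 2 * r * Real.cos θ) *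
        (1 + γ - 2 * r * Real.cos θ + t)⁻¹ = ∫ θ in (0 : ℝ)..Real.pi,
        (t⁻¹ * (Real.sin θ ^ 2 / (1 + γ - 2 * r * Real.cos θ)) - (t * κ)⁻¹ *
          (Real.sin θ ^ 2 / (1 + (r / κ) ^ 2 - 2 * (r / κ) * Real.cos θ))) := by
      rw [intervalIntegral.integral_of_le hpi.le, intervalIntegral.integral_of_le hpi.le]
      refine setIntegral_congr_fun measurableSet_Ioc fun θ hθ => ?_
      have hcos : Real.cos θ < 1 := by
        rw [← Real.cos_zero]
        exact Real.cos_lt_cos_of_nonneg_of_le_pi le_rfl hθ.2 hθ.1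
      have hx : 0 < 1 + γ - 2 * r * Real.cos θ := by
        rw [← hrr]; nlinarith [sq_nonneg (1 - r)]
      have hden : 1 + (r / κ) ^ 2 - 2 * (r / κ) * Real.cos θ =
          (1 + γ - 2 * r * Real.cos θ + t) / κ := by
        field_simp
        rw [hrr]
        linear_combination hκeq
      simp only [hden]
      field_simp
      ring
    rw [this, intervalIntegral.integral_sub (hI0.const_mul _) (hI1.const_mul _),
      intervalIntegral.integral_const_mul, intervalIntegral.integral_const_mul, hJ0, hJ1]
    field_simp
  rw [hg]
  have hinv : κ⁻¹ ≤ 1 := inv_le_one_of_one_le₀ hκ1.le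
  have e : 1 - t * ((1 - κ⁻¹) / t) = κ⁻¹ := by field_simp; ring
  refine ⟨div_nonneg (by linarith) ht.le, ?_, ?_⟩
  · have e2 : 1 + γ * ((1 - κ⁻¹) / t) = κ * ((1 - κ⁻¹) / t) := by
      field_simp
      linear_combination -hprod
    have h0 : (1 - κ⁻¹) / t ≠ 0 := by
      have : κ⁻¹ < 1 := inv_lt_one_of_one_lt₀ hκ1
      exact (div_pos (by linarith) ht).ne'
    rw [e, e2, div_mul_cancel_right₀ h0, sub_self]
  · rw [e]
    exact inv_anti₀ (by linarith) hκt

end MarchenkoPastur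

/-! ### Convergence in probability as convergence along a filter -/

section InProbability

variable {Ω Ω' : ℕ → Type*} [∀ k, MeasurableSpace (Ω k)] [∀ k, MeasurableSpace (Ω' k)]

/-- The filter whose members are the events of asymptotic probability one. A function tends to
`𝓝 c` along this filter iff it converges to `c` in probability. -/
def inProb (P : ∀ k, Measure (Ω k)) : Filter (Σ k, Ω k) where
  sets := {S | Tendsto (fun k => P k {ω | (⟨k, ω⟩ : Σ k, Ω k) ∉ S}) atTop (𝓝 0)}
  univ_sets := by simp
  sets_of_superset {S T} hS hST := by
    refine tendsto_of_tendsto_of_tendsto_of_le_of_le tendsto_const_nhds hS (fun _ => zero_le)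
      fun k => measure_mono fun ω hω h => hω (hST h)
  inter_sets {S T} hS hT := by
    have := hS.add hT
    rw [add_zero] at this
    refine tendsto_of_tendsto_of_tendsto_of_le_of_le tendsto_const_nhds this (fun _ => zero_le)
      fun k => ?_
    refine (measure_mono fun ω hω => ?_).trans (measure_union_le _ _)
    simp only [Set.mem_inter_iff, Set.mem_ofPred_eq, not_and_or] at hω
    exact hω

variable {P : ∀ k, Measure (Ω k)}

theorem mem_inProb {S : Set (Σ k, Ω k)} :
    S ∈ inProb P ↔ Tendsto (fun k => P k {ω | (⟨k, ω⟩ : Σ k, Ω k) ∉ S}) atTop (𝓝 0) := Iff.rfl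

theorem tendsto_fst_inProb : Tendsto Sigma.fst (inProb P) atTop := by
  intro S hS
  rw [mem_map, mem_inProb]
  refine tendsto_const_nhds.congr' ?_
  filter_upwards [hS] with k hk
  simp [hk]

theorem eventually_inProb_of_ae {p : (Σ k, Ω k) → Prop} (h : ∀ k, ∀ᵐ ω ∂(P k), p ⟨k, ω⟩) :
    ∀ᶠ ω in inProb P, p ω := by
  refine mem_inProb.2 (tendsto_const_nhds.congr fun k => ?_)
  exact (ae_iff.1 (h k)).symm

/-- Carries limits in probability proved for a law over to random variables with that law. The
events need not be measurable; the inequality between the measure of a preimage and the image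
measure suffices. -/
theorem tendsto_map_inProb {Q : ∀ k, Measure (Ω' k)} (F : ∀ k, Ω k → Ω' k)
    (hF : ∀ k, AEMeasurable (F k) (P k)) (hPQ : ∀ k, (P k).map (F k) = Q k) :
    Tendsto (fun ω : Σ k, Ω k => (⟨ω.1, F ω.1 ω.2⟩ : Σ k, Ω' k)) (inProb P) (inProb Q) := by
  intro S hS
  rw [mem_map, mem_inProb]
  refine tendsto_of_tendsto_of_tendsto_of_le_of_le tendsto_const_nhds hS (fun _ => zero_le)
      fun k => ?_
  rw [← hPQ k]
  exact Measure.le_map_apply (hF k) _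

/-- Convergence in mean implies convergence in probability. -/
theorem tendsto_inProb_of_lintegral_le {Y : (Σ k, Ω k) → ℝ} (hY : ∀ k, Measurable fun ω => Y ⟨k, ω⟩)
    {b : ℕ → ℝ} (hb : Tendsto b atTop (𝓝 0))
    (h : ∀ᶠ k in atTop, ∫⁻ ω, ENNReal.ofReal |Y ⟨k, ω⟩| ∂(P k) ≤ ENNReal.ofReal (b k)) :
    Tendsto Y (inProb P) (𝓝 0) := by
  rw [Metric.tendsto_nhds]
  intro ε hε
  refine mem_inProb.2 ?_
  have h0 : Tendsto (fun k => ENNReal.ofReal (b k) / ENNReal.ofReal ε) atTop (𝓝 0) := by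
    have := ENNReal.Tendsto.div_const (ENNReal.tendsto_ofReal hb) (b := ENNReal.ofReal ε)
      (Or.inr (by simpa using hε))
    simpa using this
  refine tendsto_of_tendsto_of_tendsto_of_le_of_le' tendsto_const_nhds h0
    (Eventually.of_forall fun _ => zero_le) ?_
  filter_upwards [h] with k hk
  refine le_trans (le_trans (measure_mono ?_) (meas_ge_le_lintegral_div (f := fun ω =>
    ENNReal.ofReal |Y ⟨k, ω⟩|) (hY k).abs.ennreal_ofReal.aemeasurable (ε := ENNReal.ofReal ε)
    (by simpa using hε) ENNReal.ofReal_ne_top)) (by gcongr)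
  intro ω hω
  simp only [Set.mem_ofPred_eq, not_lt, Real.dist_eq, sub_zero] at hω
  exact ENNReal.ofReal_le_ofReal hω

theorem tendsto_measure_of_tendsto_inProb {Y : (Σ k, Ω k) → ℝ} {c : ℝ}
    (h : Tendsto Y (inProb P) (𝓝 c)) {ε : ℝ} (hε : 0 < ε) :
    Tendsto (fun k => P k {ω | ε ≤ |Y ⟨k, ω⟩ - c|}) atTop (𝓝 0) := by
  have := mem_inProb.1 (Metric.tendsto_nhds.1 h ε hε)
  simpa [Real.dist_eq] using this

end InProbability

/-! ### From Stieltjes transforms on the negative half-axis to weak convergence -/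

section Stieltjes

/-- The homeomorphism `x ↦ 1 / (1 + x)` of `[0, ∞)` onto `(0, 1]`, extended to `ℝ`. -/
noncomputable def toInterval : C(ℝ, unitInterval) where
  toFun x := ⟨1 / (1 + |x|), by positivity, by
    rw [div_le_one (by positivity)]; linarith [abs_nonneg x]⟩
  continuous_toFun := by
    refine Continuous.subtype_mk (continuous_const.div (by fun_prop) fun x => ?_) _
    positivity

/-- The function `1 / (x + t)` in the coordinate `1 / (1 + x)`. -/
noncomputable def resolventMap (t : ℝ) (ht : 0 < t) : C(unitInterval, ℝ) where
  toFun u := (u : ℝ) / ((1 - u) + t * u)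
  continuous_toFun := by
    refine Continuous.div (by fun_prop) (by fun_prop) fun u => ?_
    rcases u.2.2.lt_or_eq with h | h
    · have := mul_nonneg ht.le u.2.1; exact (by linarith : (0 : ℝ) < _).ne'
    · simp [h, ht.ne']

theorem resolventMap_toInterval {t : ℝ} (ht : 0 < t) {x : ℝ} (hx : 0 ≤ x) :
    resolventMap t ht (toInterval x) = (x + t)⁻¹ := by
  simp only [resolventMap, toInterval, ContinuousMap.coe_mk, abs_of_nonneg hx]
  have h1 : (1 + x) ≠ 0 := by positivity
  have h2 : (x + t) ≠ 0 := by positivity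
  have : 1 - 1 / (1 + x) + t * (1 / (1 + x)) = (x + t) / (1 + x) := by field_simp; ring
  rw [this]
  field_simp

/-- The identity as a continuous map on the unit interval. -/
def intervalCoord : C(unitInterval, ℝ) := ⟨fun u => u, continuous_subtype_val⟩

/-- The resolvents and the constants span a dense subspace of the continuous functions. -/
theorem closure_span_resolventMap :
    (Submodule.span ℝ (insert 1 (Set.range fun t : Set.Ioi (0 : ℝ) =>
      resolventMap t.1 t.2))).topologicalClosure = (⊤ : Submodule ℝ C(unitInterval, ℝ)) := by
  set M := (Submodule.span ℝ (insert 1 (Set.range fun t : Set.Ioi (0 : ℝ) =>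
      resolventMap t.1 t.2))).topologicalClosure with hM
  have hsub : ∀ φ ∈ insert 1 (Set.range fun t : Set.Ioi (0 : ℝ) => resolventMap t.1 t.2), φ ∈ M :=
    fun φ hφ => Submodule.le_topologicalClosure _ (Submodule.subset_span hφ)
  have hres : ∀ t (ht : 0 < t), resolventMap t ht ∈ M := fun t ht =>
    hsub _ (Set.mem_insert_of_mem _ ⟨⟨t, ht⟩, rfl⟩)
  have hone : (1 : C(unitInterval, ℝ)) ∈ M := hsub _ (Set.mem_insert _ _)
  have hu : intervalCoord = resolventMap 1 one_pos := by
    ext u; simp [intervalCoord, resolventMap]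
  -- Resolvent identity: with `ρ_t` for `resolventMap t` and `u = ρ_1` for the coordinate, `u ρ_t =
  -- (ρ_1 - ρ_t) / (t - 1)`.
  have hne : ∀ t, t ≠ 1 → ∀ ht : 0 < t, intervalCoord * resolventMap t ht ∈ M := by
    intro t h1 ht
    have h1' : t - 1 ≠ 0 := sub_ne_zero.2 h1
    have : intervalCoord * resolventMap t ht =
        (t - 1)⁻¹ • (resolventMap 1 one_pos - resolventMap t ht) := by
      ext u
      have hpos : (1 - (u : ℝ)) + t * u ≠ 0 := by
        rcases u.2.2.lt_or_eq with h | h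
        · have := mul_nonneg ht.le u.2.1; exact (by linarith : (0 : ℝ) < _).ne'
        · simp [h, ht.ne']
      simp only [intervalCoord, resolventMap, ContinuousMap.mul_apply, ContinuousMap.coe_mk,
        ContinuousMap.smul_apply, ContinuousMap.sub_apply, smul_eq_mul]
      rw [eq_inv_mul_iff_mul_eq₀ h1', show 1 - (u : ℝ) + 1 * u = 1 by ring, div_one]
      field_simp
      ring
    rw [this]
    exact M.smul_mem _ (M.sub_mem (hres _ _) (hres _ _))
  have hclosed : IsClosed (M : Set C(unitInterval, ℝ)) := Submodule.isClosed_topologicalClosure _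
  -- The case excluded from the resolvent identity is the uniform limit of `t = 1 + ε / 2` as `ε →
  -- 0`, and `M` is closed.
  have hsq : intervalCoord * resolventMap 1 one_pos ∈ M := by
    rw [← SetLike.mem_coe, ← hclosed.closure_eq, Metric.mem_closure_iff]
    intro ε hε
    have ht : (0 : ℝ) < 1 + ε / 2 := by positivity
    refine ⟨_, hne (1 + ε / 2) (by linarith) ht, ?_⟩
    refine lt_of_le_of_lt ?_ (half_lt_self hε)
    rw [ContinuousMap.dist_le (by positivity)]
    intro u
    have hu0 := u.2.1
    have hu1 := u.2.2
    have hpos : 0 < 1 + (ε / 2) * (u : ℝ) := by positivity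
    have e : (intervalCoord * resolventMap 1 one_pos) u -
        (intervalCoord * resolventMap (1 + ε / 2) ht) u =
        (ε / 2) * ((u : ℝ) * u * u / (1 + (ε / 2) * u)) := by
      have h3 : (1 - (u : ℝ)) + (1 + ε / 2) * u = 1 + (ε / 2) * u := by ring
      simp only [intervalCoord, resolventMap, ContinuousMap.mul_apply, ContinuousMap.coe_mk, h3]
      have h4 : (1 - (u : ℝ)) + 1 * u = 1 := by ring
      rw [h4]
      field_simp
      ring
    rw [Real.dist_eq, e, abs_of_nonneg (by positivity)]
    have h3 : (u : ℝ) * u * u / (1 + (ε / 2) * u) ≤ 1 := by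
      rw [div_le_one hpos]
      have h5 : (u : ℝ) * u ≤ 1 := mul_le_one₀ hu1 hu0 hu1
      have h6 : (u : ℝ) * u * u ≤ 1 := mul_le_one₀ h5 hu0 hu1
      have : 0 ≤ (ε / 2) * (u : ℝ) := by positivity
      linarith
    calc _ ≤ ε / 2 * 1 := by gcongr
      _ = _ := mul_one _
  -- Stability under multiplication by the coordinate puts all polynomials into `M`; the Weierstrass
  -- theorem then finishes the proof.
  have hmul : ∀ φ ∈ M, intervalCoord * φ ∈ M := by
    have : M ≤ M.comap (LinearMap.mulLeft ℝ intervalCoord) := by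
      refine Submodule.topologicalClosure_minimal _ (Submodule.span_le.2 ?_) ?_
      · rintro φ (rfl | ⟨⟨t, ht⟩, rfl⟩)
        · simpa [hu] using hres 1 one_pos
        · by_cases h1 : t = 1
          · subst h1; exact hsq
          · exact hne t h1 ht
      · exact hclosed.preimage (continuous_const.mul continuous_id)
    exact fun φ hφ => this hφ
  have hpoly : ∀ p : Polynomial ℝ, p.toContinuousMapOn unitInterval ∈ M := by
    have hpow : ∀ n, (intervalCoord ^ n : C(unitInterval, ℝ)) ∈ M := by
      intro n
      induction n with
      | zero => simpa using hone
      | succ n ih => rw [pow_succ']; exact hmul _ ih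
    intro p
    have : p.toContinuousMapOn unitInterval =
        ∑ i ∈ Finset.range (p.natDegree + 1), p.coeff i • (intervalCoord ^ i) := by
      ext u
      simp [intervalCoord, Polynomial.eval_eq_sum_range]
    rw [this]
    exact M.sum_mem fun i _ => M.smul_mem _ (hpow i)
  rw [eq_top_iff]
  intro φ _
  have hφ : φ ∈ (polynomialFunctions unitInterval).topologicalClosure := by
    rw [polynomialFunctions_closure_eq_top']; trivial
  have : closure ((polynomialFunctions unitInterval : Set C(unitInterval, ℝ))) ⊆ M := by
    refine closure_minimal ?_ hclosed
    rw [polynomialFunctions_coe]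
    rintro _ ⟨p, rfl⟩
    exact hpoly p
  exact this hφ

variable {Ω : Type*} {l : Filter Ω} {μ : Ω → Measure ℝ} [∀ ω, IsProbabilityMeasure (μ ω)]
  {ν : Measure ℝ} [IsProbabilityMeasure ν]

theorem integrable_comp_toInterval (φ : C(unitInterval, ℝ)) :
    Integrable (fun x => φ (toInterval x)) ν := by
  refine Integrable.mono' (integrable_const ‖φ‖)
    (φ.continuous.comp toInterval.continuous).aestronglyMeasurable
    (Eventually.of_forall fun x => φ.norm_coe_le_norm _)

/-- The test functions with this property form a subspace, closed by uniform approximation, that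
contains the constants and the resolvents; `closure_span_resolventMap` shows that it is everything.
-/
theorem tendsto_integral_comp_toInterval (hμ : ∀ ω, ∀ᵐ x ∂(μ ω), 0 ≤ x) (hν : ∀ᵐ x ∂ν, 0 ≤ x)
    (h : ∀ t : ℝ, 0 < t → Tendsto (fun ω => ∫ x, (x + t)⁻¹ ∂(μ ω)) l (𝓝 (∫ x, (x + t)⁻¹ ∂ν)))
    (φ : C(unitInterval, ℝ)) :
    Tendsto (fun ω => ∫ x, φ (toInterval x) ∂(μ ω)) l (𝓝 (∫ x, φ (toInterval x) ∂ν)) := by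
  let S : Submodule ℝ C(unitInterval, ℝ) :=
    { carrier := {φ | Tendsto (fun ω => ∫ x, φ (toInterval x) ∂(μ ω)) l
        (𝓝 (∫ x, φ (toInterval x) ∂ν))}
      add_mem' := fun {φ ψ} hφ hψ => by
        have e : ∀ (ρ : Measure ℝ) [IsProbabilityMeasure ρ], ∫ x, (φ + ψ) (toInterval x) ∂ρ =
            ∫ x, φ (toInterval x) ∂ρ + ∫ x, ψ (toInterval x) ∂ρ := fun ρ _ =>
          integral_add (integrable_comp_toInterval φ) (integrable_comp_toInterval ψ)
        simp only [Set.mem_ofPred_eq, e]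
        exact hφ.add hψ
      zero_mem' := by simpa using tendsto_const_nhds
      smul_mem' := fun c φ hφ => by
        simp only [Set.mem_ofPred_eq, ContinuousMap.smul_apply, integral_smul]
        exact hφ.const_smul c }
  have hclosed : IsClosed (S : Set C(unitInterval, ℝ)) := by
    refine isClosed_of_closure_subset fun φ hφ => ?_
    change Tendsto _ _ _
    rw [Metric.tendsto_nhds]
    intro ε hε
    obtain ⟨ψ, hψ, hd⟩ := Metric.mem_closure_iff.1 hφ (ε / 3) (by positivity)
    have hψ' : Tendsto _ _ _ := hψ
    have e : ∀ (ρ : Measure ℝ) [IsProbabilityMeasure ρ],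
        |∫ x, φ (toInterval x) ∂ρ - ∫ x, ψ (toInterval x) ∂ρ| ≤ ε / 3 := by
      intro ρ _
      rw [← integral_sub (integrable_comp_toInterval φ) (integrable_comp_toInterval ψ)]
      have := norm_integral_le_of_norm_le_const (μ := ρ) (C := ε / 3)
        (f := fun x => φ (toInterval x) - ψ (toInterval x)) (Eventually.of_forall fun x => ?_)
      · simpa using this
      · rw [← dist_eq_norm]
        exact (ContinuousMap.dist_apply_le_dist _).trans hd.le
    filter_upwards [Metric.tendsto_nhds.1 hψ' (ε / 3) (by positivity)] with ω hω
    rw [Real.dist_eq] at hω ⊢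
    have h1 := e (μ ω)
    have h2 := e ν
    rw [abs_lt] at hω ⊢
    rw [abs_le] at h1 h2
    constructor <;> linarith [h1.1, h1.2, h2.1, h2.2, hω.1, hω.2]
  have hsub : (⊤ : Submodule ℝ C(unitInterval, ℝ)) ≤ S := by
    rw [← closure_span_resolventMap]
    refine Submodule.topologicalClosure_minimal _ (Submodule.span_le.2 ?_) hclosed
    rintro φ (rfl | ⟨⟨t, ht⟩, rfl⟩)
    · change Tendsto _ _ _
      simpa using tendsto_const_nhds
    · change Tendsto _ _ _
      have e : ∀ (ρ : Measure ℝ), (∀ᵐ x ∂ρ, 0 ≤ x) →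
          ∫ x, resolventMap t ht (toInterval x) ∂ρ = ∫ x, (x + t)⁻¹ ∂ρ := fun ρ hρ =>
        integral_congr_ae (hρ.mono fun x hx => resolventMap_toInterval ht hx)
      simp only [e _ hν, e _ (hμ _)]
      exact h t ht
  exact hsub (Submodule.mem_top : φ ∈ ⊤)

/-- A bounded function times a resolvent, in the coordinate `1 / (1 + x)`. -/
noncomputable def cutoffMap (f : BoundedContinuousFunction ℝ ℝ) (K : ℝ) (hK : 0 < K) :
    C(unitInterval, ℝ) where
  toFun u := f (1 / u - 1) * (K * resolventMap K hK u)
  continuous_toFun := by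
    rw [continuous_iff_continuousAt]
    intro u
    -- The point `u = 0` corresponds to `x = ∞`: there the factor with `f` may oscillate but is
    -- bounded, while the resolvent factor tends to zero.
    by_cases hu : (u : ℝ) = 0
    · have h0 : f (1 / u - 1) * (K * resolventMap K hK u) = 0 := by simp [resolventMap, hu]
      rw [ContinuousAt, h0]
      have h1 : Tendsto (fun u => ‖f‖ * |K * resolventMap K hK u|) (𝓝 u) (𝓝 0) := by
        have : ContinuousAt (fun u => ‖f‖ * |K * resolventMap K hK u|) u :=
          (continuous_const.mul (continuous_const.mul
            (resolventMap K hK).continuous).abs).continuousAt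
        have h2 : ‖f‖ * |K * resolventMap K hK u| = 0 := by simp [resolventMap, hu]
        rw [ContinuousAt, h2] at this
        exact this
      refine squeeze_zero_norm (fun v => ?_) h1
      rw [norm_mul]
      exact mul_le_mul_of_nonneg_right (f.norm_coe_le_norm _) (norm_nonneg _)
    · refine ContinuousAt.mul ?_ (continuous_const.mul (resolventMap K hK).continuous).continuousAt
      refine f.continuous.continuousAt.comp ?_
      exact (continuousAt_const.div continuous_subtype_val.continuousAt hu).sub continuousAt_const

theorem cutoffMap_toInterval (f : BoundedContinuousFunction ℝ ℝ) {K : ℝ} (hK : 0 < K) {x : ℝ}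
    (hx : 0 ≤ x) : cutoffMap f K hK (toInterval x) = f x * (K * (x + K)⁻¹) := by
  have : (1 / (toInterval x : ℝ) - 1) = x := by
    simp [toInterval, abs_of_nonneg hx]
  change f (1 / (toInterval x : ℝ) - 1) * (K * resolventMap K hK (toInterval x)) = _
  rw [this, resolventMap_toInterval hK hx]

/-- Pointwise convergence of the Stieltjes transforms on the negative half-axis implies weak
convergence of probability measures on `[0, ∞)`. -/
theorem tendsto_integral_of_tendsto_stieltjes (hμ : ∀ ω, ∀ᵐ x ∂(μ ω), 0 ≤ x)
    (hν : ∀ᵐ x ∂ν, 0 ≤ x)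
    (hK : ∀ ε : ℝ, 0 < ε → ∃ K : ℝ, 0 < K ∧ 1 - K * ∫ x, (x + K)⁻¹ ∂ν < ε)
    (h : ∀ t : ℝ, 0 < t → Tendsto (fun ω => ∫ x, (x + t)⁻¹ ∂(μ ω)) l (𝓝 (∫ x, (x + t)⁻¹ ∂ν)))
    (f : BoundedContinuousFunction ℝ ℝ) :
    Tendsto (fun ω => ∫ x, f x ∂(μ ω)) l (𝓝 (∫ x, f x ∂ν)) := by
  rw [Metric.tendsto_nhds]
  intro ε hε
  set B := ‖f‖ + 1 with hB
  have hB0 : 0 < B := by positivity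
  obtain ⟨K, hK0, hKε⟩ := hK (ε / (4 * B)) (by positivity)
  -- The mass removed by the cutoff `K / (x + K)` is read off from the Stieltjes transform at `K`,
  -- so no separate tightness bound is needed: it is small for `ν` by `hK`, and hence eventually for
  -- `μ ω`.
  have key : ∀ (ρ : Measure ℝ) [IsProbabilityMeasure ρ], (∀ᵐ x ∂ρ, 0 ≤ x) →
      |∫ x, f x ∂ρ - ∫ x, cutoffMap f K hK0 (toInterval x) ∂ρ| ≤
        B * (1 - K * ∫ x, (x + K)⁻¹ ∂ρ) := by
    intro ρ _ hρ
    have hint : Integrable (fun x => (x + K)⁻¹) ρ :=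
      (integrable_comp_toInterval (resolventMap K hK0)).congr
        (hρ.mono fun x hx => resolventMap_toInterval hK0 hx)
    have e1 : B * (1 - K * ∫ x, (x + K)⁻¹ ∂ρ) = ∫ x, B * (1 - K * (x + K)⁻¹) ∂ρ := by
      rw [integral_const_mul, integral_sub (integrable_const _) (hint.const_mul _),
        integral_const_mul]
      simp
    rw [← integral_sub (f.integrable ρ) (integrable_comp_toInterval _), e1, ← Real.norm_eq_abs]
    refine norm_integral_le_of_norm_le (((integrable_const _).sub (hint.const_mul _)).const_mul _)
      (hρ.mono fun x hx => ?_)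
    rw [cutoffMap_toInterval f hK0 hx]
    have h1 : K * (x + K)⁻¹ ≤ 1 := by
      rw [← div_eq_mul_inv, div_le_one (by positivity)]; linarith
    have h2 : f x - f x * (K * (x + K)⁻¹) = f x * (1 - K * (x + K)⁻¹) := by ring
    rw [h2, norm_mul, Real.norm_of_nonneg (sub_nonneg.2 h1)]
    refine mul_le_mul_of_nonneg_right ?_ (sub_nonneg.2 h1)
    linarith [f.norm_coe_le_norm x]
  have hlim : Tendsto (fun ω => B * (1 - K * ∫ x, (x + K)⁻¹ ∂(μ ω))) l
      (𝓝 (B * (1 - K * ∫ x, (x + K)⁻¹ ∂ν))) :=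
    ((h K hK0).const_mul K).const_sub 1 |>.const_mul B
  have hlt : B * (1 - K * ∫ x, (x + K)⁻¹ ∂ν) < ε / 4 := by
    calc _ < B * (ε / (4 * B)) := by gcongr
      _ = ε / 4 := by field_simp
  filter_upwards [hlim.eventually (gt_mem_nhds hlt), Metric.tendsto_nhds.1
    (tendsto_integral_comp_toInterval hμ hν h (cutoffMap f K hK0)) (ε / 4) (by positivity)]
    with ω h1 h2
  have h3 := key (μ ω) (hμ ω)
  have h4 := key ν hν
  rw [Real.dist_eq] at h2 ⊢
  rw [abs_lt] at h2 ⊢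
  rw [abs_le] at h3 h4
  constructor <;> linarith [h3.1, h3.2, h4.1, h4.2, h2.1, h2.2]

end Stieltjes

/-! ### Deterministic leave-one-out identities for the resolvent -/

section Resolvent

open Matrix

variable {m n : Type*} [Fintype m] [Fintype n]

theorem posSemidef_transpose_mul_self (X : Matrix m n ℝ) : (Xᵀ * X).PosSemidef := by
  simpa [conjTranspose_eq_transpose_of_trivial] using posSemidef_conjTranspose_mul_self X

variable [DecidableEq n]

/-- The resolvent `(Xᵀ X + T)⁻¹` of the Wishart matrix of `X`. -/
noncomputable def wishartResolvent (X : Matrix m n ℝ) (T : ℝ) : Matrix n n ℝ :=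
  (Xᵀ * X + T • (1 : Matrix n n ℝ))⁻¹

theorem isUnit_wishart_add (X : Matrix m n ℝ) {T : ℝ} (hT : 0 < T) :
    IsUnit (Xᵀ * X + T • (1 : Matrix n n ℝ)) :=
  (PosDef.posSemidef_add (posSemidef_transpose_mul_self X) (PosDef.one.smul hT)).isUnit

/-- Spectral decomposition of the resolvent of a rescaled real Wishart matrix. -/
theorem resolvent_spectral (X : Matrix m n ℝ) {T : ℝ} (hT : 0 < T) :
    wishartResolvent X T =
      ((posSemidef_transpose_mul_self X).1.eigenvectorUnitary : Matrix n n ℝ) *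
        diagonal (fun i => ((posSemidef_transpose_mul_self X).1.eigenvalues i + T)⁻¹) *
        ((posSemidef_transpose_mul_self X).1.eigenvectorUnitary : Matrix n n ℝ)ᵀ := by
  set hX := (posSemidef_transpose_mul_self X).1
  set U : Matrix n n ℝ := hX.eigenvectorUnitary.1 with hU
  have h1 : Xᵀ * X = U * diagonal hX.eigenvalues * Uᵀ := by
    have := hX.spectral_theorem
    rw [Unitary.conjStarAlgAut_apply] at this
    rw [star_eq_conjTranspose, conjTranspose_eq_transpose_of_trivial] at this
    exact this
  have hUU : U * Uᵀ = 1 := by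
    have : U * star U = 1 := Unitary.coe_mul_star_self _
    rwa [star_eq_conjTranspose, conjTranspose_eq_transpose_of_trivial] at this
  have hUU' : Uᵀ * U = 1 := mul_eq_one_comm.1 hUU
  have hev : ∀ i, 0 ≤ hX.eigenvalues i := (posSemidef_transpose_mul_self X).eigenvalues_nonneg
  refine inv_eq_left_inv ?_
  have h2 : Xᵀ * X + T • (1 : Matrix n n ℝ) =
      U * diagonal (fun i => hX.eigenvalues i + T) * Uᵀ := by
    have : diagonal (fun i => hX.eigenvalues i + T) = diagonal hX.eigenvalues + T • 1 := by
      rw [← diagonal_one, ← diagonal_smul, diagonal_add]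
      congr; ext i; simp
    rw [this, Matrix.mul_add, Matrix.add_mul, ← h1, Matrix.mul_smul, Matrix.smul_mul,
      Matrix.mul_one, hUU]
  rw [h2]
  calc _ = U * diagonal (fun i => (hX.eigenvalues i + T)⁻¹) * (Uᵀ * U) *
      diagonal (fun i => hX.eigenvalues i + T) * Uᵀ := by simp only [Matrix.mul_assoc]
    _ = U * (diagonal (fun i => (hX.eigenvalues i + T)⁻¹) *
      diagonal (fun i => hX.eigenvalues i + T)) * Uᵀ := by
        rw [hUU', Matrix.mul_one, Matrix.mul_assoc U]
    _ = 1 := by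
      rw [diagonal_mul_diagonal]
      have : (fun i => (hX.eigenvalues i + T)⁻¹ * (hX.eigenvalues i + T)) = fun _ => 1 := by
        ext i
        exact inv_mul_cancel₀ (by linarith [hev i])
      rw [this, diagonal_one, Matrix.mul_one, hUU]

theorem trace_wishartResolvent (X : Matrix m n ℝ) {T : ℝ} (hT : 0 < T) :
    (wishartResolvent X T).trace =
      ∑ i, ((posSemidef_transpose_mul_self X).1.eigenvalues i + T)⁻¹ := by
  have hUU := Unitary.coe_star_mul_self (posSemidef_transpose_mul_self X).1.eigenvectorUnitary
  rw [star_eq_conjTranspose, conjTranspose_eq_transpose_of_trivial] at hUU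
  rw [resolvent_spectral X hT, trace_mul_comm, ← Matrix.mul_assoc, hUU, Matrix.one_mul,
    trace_diagonal]

theorem trace_wishartResolvent_nonneg (X : Matrix m n ℝ) {T : ℝ} (hT : 0 < T) :
    0 ≤ (wishartResolvent X T).trace := by
  rw [trace_wishartResolvent X hT]
  exact Finset.sum_nonneg fun i _ => inv_nonneg.2
    (add_nonneg ((posSemidef_transpose_mul_self X).eigenvalues_nonneg i) hT.le)

theorem wishart_mulVec_resolvent_mulVec {T : ℝ} (hT : 0 < T) (Y : Matrix m n ℝ) (v : n → ℝ) :
    (Yᵀ * Y + T • (1 : Matrix n n ℝ)) *ᵥ (wishartResolvent Y T *ᵥ v) = v := by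
  rw [mulVec_mulVec, wishartResolvent,
    mul_nonsing_inv _ ((isUnit_iff_isUnit_det _).1 (isUnit_wishart_add Y hT)), one_mulVec]

/-- With `w = R v` one has `v · w = |Y w|² + T |w|²`; in other words `T R² ≤ R` as quadratic forms.
-/
theorem mul_sq_resolvent_mulVec_le {T : ℝ} (hT : 0 < T) (Y : Matrix m n ℝ) (v : n → ℝ) :
    T * ((wishartResolvent Y T *ᵥ v) ⬝ᵥ (wishartResolvent Y T *ᵥ v)) ≤
      v ⬝ᵥ wishartResolvent Y T *ᵥ v := by
  set w := wishartResolvent Y T *ᵥ v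
  have h := wishart_mulVec_resolvent_mulVec hT Y v
  rw [add_mulVec, smul_mulVec, one_mulVec, ← mulVec_mulVec] at h
  have h2 : v ⬝ᵥ w = (Y *ᵥ w) ⬝ᵥ (Y *ᵥ w) + T * (w ⬝ᵥ w) := by
    conv_lhs => rw [← h]
    rw [add_dotProduct, smul_dotProduct, smul_eq_mul, mulVec_transpose, ← dotProduct_mulVec]
  rw [h2]
  have : 0 ≤ (Y *ᵥ w) ⬝ᵥ (Y *ᵥ w) := by
    simpa using dotProduct_star_self_nonneg (Y *ᵥ w)
  linarith

variable [DecidableEq m]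

/-- The matrix with row `a` replaced by zero. -/
def eraseRow {m n : Type*} [DecidableEq m] (X : Matrix m n ℝ) (a : m) : Matrix m n ℝ :=
  Function.update X a 0

theorem eraseRow_self {m n : Type*} [DecidableEq m] (X : Matrix m n ℝ) (a : m) :
    eraseRow X a a = 0 :=
  Function.update_self ..

theorem eraseRow_of_ne {m n : Type*} [DecidableEq m] (X : Matrix m n ℝ) {a b : m} (h : b ≠ a) :
    eraseRow X a b = X b :=
  Function.update_of_ne h ..

theorem transpose_mul_self_eq_update {n : Type*} (X : Matrix m n ℝ) (a : m) :
    Xᵀ * X = (eraseRow X a)ᵀ * (eraseRow X a) +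
      vecMulVec (X a) (X a) := by
  ext i j
  simp only [mul_apply, Matrix.add_apply, transpose_apply, vecMulVec_apply]
  rw [← Finset.add_sum_erase _ _ (Finset.mem_univ a),
    ← Finset.add_sum_erase (a := a) _ (fun x => (eraseRow X a) x i *
      (eraseRow X a) x j) (Finset.mem_univ a), eraseRow_self]
  have : ∑ x ∈ Finset.univ.erase a, (eraseRow X a) x i *
      (eraseRow X a) x j = ∑ x ∈ Finset.univ.erase a, X x i * X x j :=
    Finset.sum_congr rfl fun x hx => by rw [eraseRow_of_ne X (Finset.ne_of_mem_erase hx)]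
  rw [this]
  simp [add_comm]

/-- The quadratic form of the resolvent with row `a` left out, evaluated at that row. -/
noncomputable def leaveOneOut (X : Matrix m n ℝ) (T : ℝ) (a : m) : ℝ :=
  X a ⬝ᵥ (wishartResolvent (eraseRow X a) T) *ᵥ (X a)

theorem leaveOneOut_nonneg (X : Matrix m n ℝ) (a : m) {T : ℝ} (hT : 0 < T) :
    0 ≤ leaveOneOut X T a := by
  refine le_trans ?_ (mul_sq_resolvent_mulVec_le hT (eraseRow X a) (X a))
  refine mul_nonneg hT.le ?_
  simpa using dotProduct_star_self_nonneg (wishartResolvent (eraseRow X a) T *ᵥ X a)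

/-- Sherman–Morrison: restoring row `a` is a rank-one perturbation, and the full matrix sends `w` to
`(1 + leaveOneOut X T a)` times that row. -/
theorem wishartResolvent_mulVec_row (X : Matrix m n ℝ) (a : m) {T : ℝ} (hT : 0 < T) :
    wishartResolvent X T *ᵥ (X a) =
      (1 + leaveOneOut X T a)⁻¹ • (wishartResolvent (eraseRow X a) T *ᵥ (X a)) := by
  set w := wishartResolvent (eraseRow X a) T *ᵥ (X a) with hw
  have hq := leaveOneOut_nonneg X a hT
  have h1 : (Xᵀ * X + T • (1 : Matrix n n ℝ)) *ᵥ w = (1 + leaveOneOut X T a) • X a := by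
    rw [transpose_mul_self_eq_update X a, add_right_comm, add_mulVec,
      wishart_mulVec_resolvent_mulVec hT, vecMulVec_mulVec, add_smul, one_smul]
    simp [leaveOneOut, hw]
  have h2 : X a = (1 + leaveOneOut X T a)⁻¹ • ((Xᵀ * X + T • (1 : Matrix n n ℝ)) *ᵥ w) := by
    rw [h1, smul_smul, inv_mul_cancel₀ (by positivity), one_smul]
  conv_lhs => rw [h2]
  rw [mulVec_smul, mulVec_mulVec, wishartResolvent,
    nonsing_inv_mul _ ((isUnit_iff_isUnit_det _).1 (isUnit_wishart_add X hT)), one_mulVec]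

theorem row_dotProduct_resolvent (X : Matrix m n ℝ) (a : m) {T : ℝ} (hT : 0 < T) :
    X a ⬝ᵥ wishartResolvent X T *ᵥ (X a) = leaveOneOut X T a / (1 + leaveOneOut X T a) := by
  rw [wishartResolvent_mulVec_row X a hT, dotProduct_smul, smul_eq_mul, inv_mul_eq_div, leaveOneOut]

/-- Since `XᵀX R = 1 - T R`, the left side is the trace of `XᵀX R`, which by cyclicity is a sum of
quadratic forms over the rows. -/
theorem trace_transpose_mul_self_mul_resolvent (X : Matrix m n ℝ) {T : ℝ} (hT : 0 < T) :
    (Fintype.card n : ℝ) - T * (wishartResolvent X T).trace =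
      ∑ a, leaveOneOut X T a / (1 + leaveOneOut X T a) := by
  have h1 : Xᵀ * X * wishartResolvent X T = 1 - T • wishartResolvent X T := by
    have : (Xᵀ * X + T • (1 : Matrix n n ℝ)) * wishartResolvent X T = 1 :=
      mul_nonsing_inv _ ((isUnit_iff_isUnit_det _).1 (isUnit_wishart_add X hT))
    rw [Matrix.add_mul, smul_mul, Matrix.one_mul] at this
    rw [← this, add_sub_cancel_right]
  have h2 : (Xᵀ * X * wishartResolvent X T).trace =
      ∑ a, X a ⬝ᵥ wishartResolvent X T *ᵥ (X a) := by
    rw [Matrix.mul_assoc, trace_mul_comm, Matrix.trace]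
    refine Finset.sum_congr rfl fun a _ => ?_
    rw [dotProduct_mulVec]
    simp only [diag_apply, mul_apply, dotProduct, vecMul, transpose_apply]
  rw [← Finset.sum_congr rfl fun a _ => row_dotProduct_resolvent X a hT, ← h2, h1, trace_sub,
    trace_one, trace_smul, smul_eq_mul]

/-- The resolvents differ by a matrix of rank at most one with trace `|w|² / (1 + q)`, and `T |w|² ≤
q`. The bound is uniform in `X` and in the dimensions. -/
theorem abs_trace_resolvent_update_sub_le (X : Matrix m n ℝ) (a : m) {T : ℝ}
    (hT : 0 < T) :
    |(wishartResolvent (eraseRow X a) T).trace -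
      (wishartResolvent X T).trace| ≤ 1 / T := by
  set Y : Matrix m n ℝ := eraseRow X a with hY
  set w := wishartResolvent Y T *ᵥ (X a) with hw
  set q := leaveOneOut X T a with hqdef
  have hq : 0 ≤ q := leaveOneOut_nonneg X a hT
  have hC : wishartResolvent X T * (Xᵀ * X + T • (1 : Matrix n n ℝ)) = 1 :=
    nonsing_inv_mul _ ((isUnit_iff_isUnit_det _).1 (isUnit_wishart_add X hT))
  have hB : (Yᵀ * Y + T • (1 : Matrix n n ℝ)) * wishartResolvent Y T = 1 :=
    mul_nonsing_inv _ ((isUnit_iff_isUnit_det _).1 (isUnit_wishart_add Y hT))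
  have hsymm : (wishartResolvent Y T)ᵀ = wishartResolvent Y T := by
    rw [wishartResolvent, transpose_nonsing_inv]
    simp
  have h1 : wishartResolvent Y T - wishartResolvent X T =
      wishartResolvent X T * vecMulVec (X a) (X a) * wishartResolvent Y T := by
    have e : vecMulVec (X a) (X a) =
        (Xᵀ * X + T • (1 : Matrix n n ℝ)) - (Yᵀ * Y + T • (1 : Matrix n n ℝ)) := by
      rw [transpose_mul_self_eq_update X a]; abel
    rw [e, Matrix.mul_sub, hC, Matrix.sub_mul, Matrix.one_mul, Matrix.mul_assoc, hB,
      Matrix.mul_one]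
  have h2 : (wishartResolvent Y T).trace - (wishartResolvent X T).trace =
      (1 + q)⁻¹ * (w ⬝ᵥ w) := by
    rw [← trace_sub, h1, mul_vecMulVec, vecMulVec_mul, trace_vecMulVec,
      wishartResolvent_mulVec_row X a hT, smul_dotProduct, smul_eq_mul, ← mulVec_transpose, hsymm]
  have h3 : T * (w ⬝ᵥ w) ≤ q := mul_sq_resolvent_mulVec_le hT Y (X a)
  have h4 : 0 ≤ w ⬝ᵥ w := by simpa using dotProduct_star_self_nonneg w
  rw [h2, abs_of_nonneg (by positivity), inv_mul_eq_div, div_le_div_iff₀ (by positivity) hT]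
  linarith

/-- The map `q ↦ q / (1 + q)` is 1-Lipschitz on `[0, ∞)`, so each leave-one-out form may be replaced
by the common trace at the cost of its fluctuation and the rank-one error. -/
theorem abs_card_sub_trace_resolvent_le (X : Matrix m n ℝ) {T : ℝ} (hT : 0 < T) :
    |(Fintype.card n : ℝ) - T * (wishartResolvent X T).trace -
      Fintype.card m * ((wishartResolvent X T).trace / (1 + (wishartResolvent X T).trace))| ≤
      ∑ a, (|leaveOneOut X T a - (wishartResolvent (eraseRow X a) T).trace|
        + 1 / T) := by
  set τ := (wishartResolvent X T).trace with hτ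
  have hτ0 : 0 ≤ τ := trace_wishartResolvent_nonneg X hT
  have hlip : ∀ q : ℝ, 0 ≤ q → |q / (1 + q) - τ / (1 + τ)| ≤ |q - τ| := by
    intro q hq
    have : q / (1 + q) - τ / (1 + τ) = (q - τ) / ((1 + q) * (1 + τ)) := by
      have h1 : 1 + q ≠ 0 := by positivity
      have h2 : 1 + τ ≠ 0 := by positivity
      field_simp
      ring
    rw [this, abs_div]
    refine div_le_self (abs_nonneg _) ?_
    rw [abs_of_nonneg (by positivity)]
    nlinarith [mul_nonneg hq hτ0]
  have hsum : (Fintype.card m : ℝ) * (τ / (1 + τ)) = ∑ _a : m, τ / (1 + τ) := by simp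
  rw [trace_transpose_mul_self_mul_resolvent X hT, hsum, ← Finset.sum_sub_distrib]
  refine (Finset.abs_sum_le_sum_abs _ _).trans (Finset.sum_le_sum fun a _ => ?_)
  refine (hlip _ (leaveOneOut_nonneg X a hT)).trans ?_
  have := abs_trace_resolvent_update_sub_le X a hT
  have h2 := abs_sub_le (leaveOneOut X T a)
    (wishartResolvent (eraseRow X a) T).trace τ
  linarith

end Resolvent

/-! ### Concentration of Gaussian quadratic forms in mean -/

section Concentration

/-- This is Cauchy–Schwarz, in the form that `|X - E X|` has nonnegative variance. -/
theorem lintegral_abs_sub_integral_le {Ω : Type*} [MeasurableSpace Ω] {μ : Measure Ω}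
    [IsProbabilityMeasure μ] {X : Ω → ℝ} (hX : MemLp X 2 μ) :
    ∫⁻ ω, ENNReal.ofReal |X ω - μ[X]| ∂μ ≤ ENNReal.ofReal (Real.sqrt (Var[X; μ])) := by
  have hY : MemLp (fun ω => |X ω - μ[X]|) 2 μ := (hX.sub (memLp_const _)).abs
  rw [← ofReal_integral_eq_lintegral_ofReal (hY.integrable one_le_two)
    (Eventually.of_forall fun _ => abs_nonneg _)]
  refine ENNReal.ofReal_le_ofReal (Real.le_sqrt_of_sq_le ?_)
  have h1 := variance_nonneg (fun ω => |X ω - μ[X]|) μ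
  rw [variance_eq_sub hY] at h1
  have h2 : Var[X; μ] = ∫ ω, ((fun ω => |X ω - μ[X]|) ^ 2) ω ∂μ := by
    rw [variance_eq_integral hX.aestronglyMeasurable.aemeasurable]
    simp
  rw [h2]
  linarith

/-- The variance of the square of a standard Gaussian variable. -/
noncomputable def gaussSqVar : ℝ := Var[fun x : ℝ => x ^ 2; gaussianReal 0 1]

theorem memLp_sq_gaussianReal : MemLp (fun x : ℝ => x ^ 2) 2 (gaussianReal 0 1) := by
  have h4 : MemLp (id : ℝ → ℝ) 4 (gaussianReal 0 1) := memLp_id_gaussianReal' 4 (by simp)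
  have : ENNReal.HolderTriple 4 4 2 := ⟨by
    rw [show (4 : ℝ≥0∞) = 2 * 2 by norm_num,
      ENNReal.mul_inv (Or.inl two_ne_zero) (Or.inl ENNReal.ofNat_ne_top), ← mul_add,
      ENNReal.inv_two_add_inv_two, mul_one]⟩
  simpa [sq] using h4.mul' (r := 2) h4

theorem integral_sq_gaussianReal : ∫ x : ℝ, x ^ 2 ∂(gaussianReal 0 1) = 1 := by
  have h := variance_eq_sub (memLp_id_gaussianReal' (μ := 0) (v := 1) 2 (by simp))
  rw [variance_id_gaussianReal] at h
  simpa using h.symm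

variable {ι m n : Type*} [Fintype ι] [Fintype m] [Fintype n]

/-- Concentration of a diagonal quadratic form of a standard Gaussian vector. -/
theorem lintegral_abs_sum_sq_sub_le (lam : ι → ℝ) {L : ℝ} (hL : 0 ≤ L) (h : ∀ i, |lam i| ≤ L) :
    ∫⁻ x, ENNReal.ofReal |∑ i, lam i * x i ^ 2 - ∑ i, lam i|
      ∂(Measure.pi fun _ : ι => gaussianReal 0 1) ≤
      ENNReal.ofReal (L * Real.sqrt (gaussSqVar * Fintype.card ι)) := by
  have hm : ∀ i, MemLp (fun x : ℝ => lam i * x ^ 2) 2 (gaussianReal 0 1) :=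
    fun i => memLp_sq_gaussianReal.const_mul _
  have hm' : ∀ i, MemLp (fun x : ι → ℝ => lam i * x i ^ 2) 2
      (Measure.pi fun _ : ι => gaussianReal 0 1) := fun i =>
    (hm i).comp_measurePreserving (measurePreserving_eval _ i)
  have hmem : MemLp (fun x : ι → ℝ => ∑ i, lam i * x i ^ 2) 2
      (Measure.pi fun _ : ι => gaussianReal 0 1) := memLp_finsetSum _ fun i _ => hm' i
  have hint : ∫ x, ∑ i, lam i * x i ^ 2 ∂(Measure.pi fun _ : ι => gaussianReal 0 1) =
      ∑ i, lam i := by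
    rw [integral_finsetSum _ fun i _ => (hm' i).integrable one_le_two]
    refine Finset.sum_congr rfl fun i _ => ?_
    rw [integral_const_mul]
    have := integral_comp_eval (μ := fun _ : ι => gaussianReal 0 1) (i := i)
      (f := fun x : ℝ => x ^ 2) memLp_sq_gaussianReal.aestronglyMeasurable
    rw [this, integral_sq_gaussianReal, mul_one]
  have hvar : Var[fun x : ι → ℝ => ∑ i, lam i * x i ^ 2;
      Measure.pi fun _ : ι => gaussianReal 0 1] = ∑ i, lam i ^ 2 * gaussSqVar := by
    have h1 := variance_sum_pi (μ := fun _ : ι => gaussianReal 0 1) hm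
    have h2 : (∑ i, fun ω : ι → ℝ => lam i * ω i ^ 2) = fun x : ι → ℝ => ∑ i, lam i * x i ^ 2 := by
      ext x; simp
    rw [← h2, h1]
    refine Finset.sum_congr rfl fun i _ => ?_
    rw [variance_const_mul, gaussSqVar]
  have key := lintegral_abs_sub_integral_le hmem
  rw [hint, hvar] at key
  refine key.trans (ENNReal.ofReal_le_ofReal ?_)
  rw [show L * Real.sqrt (gaussSqVar * Fintype.card ι) =
    Real.sqrt (L ^ 2 * (gaussSqVar * Fintype.card ι)) by
      rw [Real.sqrt_mul (sq_nonneg L), Real.sqrt_sq hL]]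
  refine Real.sqrt_le_sqrt ?_
  have h0 : 0 ≤ gaussSqVar := variance_nonneg _ _
  calc ∑ i, lam i ^ 2 * gaussSqVar ≤ ∑ _i : ι, L ^ 2 * gaussSqVar := by
        refine Finset.sum_le_sum fun i _ => mul_le_mul_of_nonneg_right ?_ h0
        rw [← sq_abs]
        exact pow_le_pow_left₀ (abs_nonneg _) (h i) 2
    _ = L ^ 2 * (gaussSqVar * Fintype.card ι) := by simp; ring

variable [DecidableEq n]

open Matrix in
/-- Concentration of the quadratic form of a resolvent. -/
theorem lintegral_abs_resolvent_form_sub_trace_le (Y : Matrix m n ℝ) {T : ℝ} (hT : 0 < T) :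
    ∫⁻ x, ENNReal.ofReal |x ⬝ᵥ wishartResolvent Y T *ᵥ x - (wishartResolvent Y T).trace|
      ∂(Measure.pi fun _ : n => gaussianReal 0 1) ≤
      ENNReal.ofReal (T⁻¹ * Real.sqrt (gaussSqVar * Fintype.card n)) := by
  set hY := (posSemidef_transpose_mul_self Y).1
  set U : Matrix n n ℝ := hY.eigenvectorUnitary.1 with hU
  have hUU' : Uᵀ * U = 1 := by
    have := Unitary.coe_star_mul_self hY.eigenvectorUnitary
    rwa [star_eq_conjTranspose, conjTranspose_eq_transpose_of_trivial] at this
  -- By rotation invariance the coordinates in an eigenbasis of `YᵀY` are again standard Gaussian;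
  -- there the form is diagonal with coefficients in `[0, T⁻¹]`.
  have hlaw := map_mulVec_pi_gaussianReal 1 Uᵀ (by simpa using hUU')
  have hev : ∀ i, 0 ≤ hY.eigenvalues i := (posSemidef_transpose_mul_self Y).eigenvalues_nonneg
  have key := lintegral_abs_sum_sq_sub_le (fun i => (hY.eigenvalues i + T)⁻¹) (L := T⁻¹)
    (by positivity) (fun i => by
      rw [abs_of_nonneg (inv_nonneg.2 (add_nonneg (hev i) hT.le))]
      exact inv_anti₀ hT (by linarith [hev i]))
  rw [← hlaw, lintegral_map (by fun_prop) (by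
    refine measurable_pi_lambda _ fun k => ?_
    simp only [Matrix.mulVec, dotProduct]
    fun_prop)] at key
  refine le_trans (le_of_eq ?_) key
  refine lintegral_congr fun x => ?_
  rw [trace_wishartResolvent Y hT]
  congr 3
  have h1 : (Uᵀ *ᵥ x) ⬝ᵥ (diagonal (fun i => (hY.eigenvalues i + T)⁻¹) *ᵥ (Uᵀ *ᵥ x)) =
      ∑ i, (hY.eigenvalues i + T)⁻¹ * (Uᵀ *ᵥ x) i ^ 2 := by
    simp only [dotProduct, mulVec_diagonal]
    exact Finset.sum_congr rfl fun i _ => by ring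
  rw [← h1, resolvent_spectral Y hT, ← mulVec_mulVec, ← mulVec_mulVec, mulVec_transpose U x,
    ← dotProduct_mulVec]

end Concentration

/-! ### Independence of a row from the resolvent without it -/

section LeaveOneOut

open Matrix

/-- Resampling one coordinate leaves a product measure invariant. -/
theorem map_update_pi {ι : Type*} [Fintype ι] [DecidableEq ι] {E : ι → Type*}
    [∀ i, MeasurableSpace (E i)] (μ : ∀ i, Measure (E i)) [∀ i, IsProbabilityMeasure (μ i)]
    (a : ι) :
    ((Measure.pi μ).prod (μ a)).map (fun p => Function.update p.1 a p.2) = Measure.pi μ := by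
  refine (Measure.pi_eq fun s hs => ?_).symm
  have hm : Measurable fun p : (∀ i, E i) × E a => Function.update p.1 a p.2 := measurable_update'
  have hpre : (fun p : (∀ i, E i) × E a => Function.update p.1 a p.2) ⁻¹' (Set.univ.pi s) =
      (Set.univ.pi (Function.update s a Set.univ)) ×ˢ s a := by
    ext ⟨x, y⟩
    simp only [Set.mem_preimage, Set.mem_pi, Set.mem_univ, true_imp_iff, Set.mem_prod]
    constructor
    · intro h
      refine ⟨fun i => ?_, by simpa using h a⟩
      by_cases hi : i = a
      · subst hi; simp
      · simpa [hi] using h i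
    · rintro ⟨h1, h2⟩ i
      by_cases hi : i = a
      · subst hi; simpa using h2
      · simpa [hi] using h1 i
  rw [Measure.map_apply hm (MeasurableSet.univ_pi hs), hpre, Measure.prod_prod, Measure.pi_pi,
    ← Finset.mul_prod_erase _ _ (Finset.mem_univ a),
    ← Finset.mul_prod_erase _ (fun i => μ i (s i)) (Finset.mem_univ a), Function.update_self,
    measure_univ, one_mul, mul_comm]
  congr 1
  refine Finset.prod_congr rfl fun i hi => ?_
  rw [Function.update_of_ne (Finset.ne_of_mem_erase hi)]

variable {m n : Type*} [Fintype m] [Fintype n] [DecidableEq m] [DecidableEq n]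

theorem continuous_wishartResolvent {m : Type*} [Fintype m] {T : ℝ} (hT : 0 < T) :
    Continuous fun X : Matrix m n ℝ => wishartResolvent X T := by
  have hA : Continuous fun X : Matrix m n ℝ => Xᵀ * X + T • (1 : Matrix n n ℝ) := by fun_prop
  have hdet : ∀ X : Matrix m n ℝ, (Xᵀ * X + T • (1 : Matrix n n ℝ)).det ≠ 0 := fun X =>
    ((isUnit_iff_isUnit_det _).1 (isUnit_wishart_add X hT)).ne_zero
  simp only [wishartResolvent, Matrix.inv_def, Ring.inverse_eq_inv']
  exact (hA.matrix_det.inv₀ hdet).smul hA.matrix_adjugate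

theorem continuous_leaveOneOut {T : ℝ} (hT : 0 < T) (a : m) :
    Continuous fun X : Matrix m n ℝ =>
      leaveOneOut X T a - (wishartResolvent (eraseRow X a) T).trace := by
  have h1 : Continuous fun X : Matrix m n ℝ => eraseRow X a :=
    Continuous.update continuous_id a continuous_const
  have h2 := (continuous_wishartResolvent (m := m) (n := n) hT).comp h1
  have h3 : Continuous fun X : Matrix m n ℝ => X a := continuous_apply a
  exact (h3.dotProduct (h2.matrix_mulVec h3)).sub h2.matrix_trace

/-- The matrix with row `a` replaced by `x`. -/
def replaceRow {m n : Type*} [DecidableEq m] (X : Matrix m n ℝ) (a : m) (x : n → ℝ) :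
    Matrix m n ℝ :=
  Function.update X a x

/-- Resampling row `a` preserves the law of the matrix, and the erased matrix does not see that row.
With the other rows fixed, the bound for a deterministic resolvent applies uniformly. -/
theorem lintegral_abs_leaveOneOut_sub_le {T : ℝ} (hT : 0 < T) (a : m) :
    ∫⁻ X, ENNReal.ofReal |leaveOneOut X T a - (wishartResolvent (eraseRow X a) T).trace|
      ∂(iidMatrix m n (gaussianReal 0 1)) ≤
      ENNReal.ofReal (T⁻¹ * Real.sqrt (gaussSqVar * Fintype.card n)) := by
  have hlaw : ((iidMatrix m n (gaussianReal 0 1)).prod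
      (Measure.pi fun _ : n => gaussianReal 0 1)).map
        (fun p => replaceRow p.1 a p.2) = iidMatrix m n (gaussianReal 0 1) :=
    map_update_pi (fun _ : m => Measure.pi fun _ : n => gaussianReal 0 1) a
  have hF : Measurable fun X : Matrix m n ℝ =>
      ENNReal.ofReal |leaveOneOut X T a - (wishartResolvent (eraseRow X a) T).trace| :=
    (continuous_leaveOneOut hT a).measurable.abs.ennreal_ofReal
  have hm : Measurable fun p : Matrix m n ℝ × (n → ℝ) =>
      replaceRow p.1 a p.2 := measurable_update' (X := fun _ : m => n → ℝ)
  rw [← hlaw, lintegral_map hF hm]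
  refine (lintegral_prod_le _).trans ?_
  have hb : ∀ X : Matrix m n ℝ, ∫⁻ x, ENNReal.ofReal
      |leaveOneOut (replaceRow X a x) T a -
        (wishartResolvent (eraseRow (replaceRow X a x) a) T).trace|
      ∂(Measure.pi fun _ : n => gaussianReal 0 1) ≤
      ENNReal.ofReal (T⁻¹ * Real.sqrt (gaussSqVar * Fintype.card n)) := by
    intro X
    have h1 : ∀ x : n → ℝ, eraseRow (replaceRow X a x) a = eraseRow X a :=
      fun x => Function.update_idem ..
    have h2 : ∀ x : n → ℝ, (replaceRow X a x) a = x :=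
      fun x => Function.update_self ..
    simp only [leaveOneOut, h1, h2]
    exact lintegral_abs_resolvent_form_sub_trace_le (eraseRow X a) hT
  refine (lintegral_mono hb).trans ?_
  simp

/-- The self-consistent equation of the Marchenko–Pastur law holds for the resolvent of a real
Gaussian Wishart matrix, with an explicit error in mean. -/
theorem lintegral_abs_card_sub_trace_resolvent_le {T : ℝ} (hT : 0 < T) :
    ∫⁻ X, ENNReal.ofReal |(Fintype.card n : ℝ) - T * (wishartResolvent X T).trace -
      Fintype.card m * ((wishartResolvent X T).trace / (1 + (wishartResolvent X T).trace))|
      ∂(iidMatrix m n (gaussianReal 0 1)) ≤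
      ENNReal.ofReal (Fintype.card m * (Real.sqrt (gaussSqVar * Fintype.card n) + 1) / T) := by
  have hF : ∀ a : m, Measurable fun X : Matrix m n ℝ =>
      ENNReal.ofReal |leaveOneOut X T a - (wishartResolvent (eraseRow X a) T).trace| := fun a =>
    (continuous_leaveOneOut hT a).measurable.abs.ennreal_ofReal
  have h1 : ∀ X : Matrix m n ℝ, ENNReal.ofReal |(Fintype.card n : ℝ) -
      T * (wishartResolvent X T).trace -
      Fintype.card m * ((wishartResolvent X T).trace / (1 + (wishartResolvent X T).trace))| ≤
      ∑ a, (ENNReal.ofReal |leaveOneOut X T a - (wishartResolvent (eraseRow X a) T).trace|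
        + ENNReal.ofReal (1 / T)) := by
    intro X
    refine (ENNReal.ofReal_le_ofReal (abs_card_sub_trace_resolvent_le X hT)).trans (le_of_eq ?_)
    rw [ENNReal.ofReal_sum_of_nonneg fun a _ => by positivity]
    exact Finset.sum_congr rfl fun a _ => ENNReal.ofReal_add (abs_nonneg _) (by positivity)
  refine (lintegral_mono h1).trans ?_
  rw [lintegral_finsetSum _ fun a _ => (hF a).add_const _]
  have h2 : ∀ a : m, ∫⁻ X, (ENNReal.ofReal |leaveOneOut X T a -
      (wishartResolvent (eraseRow X a) T).trace| + ENNReal.ofReal (1 / T))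
      ∂(iidMatrix m n (gaussianReal 0 1)) ≤
      ENNReal.ofReal (T⁻¹ * Real.sqrt (gaussSqVar * Fintype.card n) + 1 / T) := by
    intro a
    rw [lintegral_add_left (hF a), lintegral_const, measure_univ, mul_one,
      ENNReal.ofReal_add (by positivity) (by positivity)]
    gcongr
    exact lintegral_abs_leaveOneOut_sub_le hT a
  refine (Finset.sum_le_sum fun a _ => h2 a).trans (le_of_eq ?_)
  rw [Finset.sum_const, Finset.card_univ, nsmul_eq_mul, ← ENNReal.ofReal_natCast,
    ← ENNReal.ofReal_mul (by positivity)]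
  congr 1
  field_simp

end LeaveOneOut

/-! ### Stability of the self-consistent equation and the Wishart limit -/

section Asymptotics

variable {m n : ℕ → Type} [∀ k, Fintype (m k)] [∀ k, Fintype (n k)] [∀ k, DecidableEq (n k)]

/-- All difference quotients of `h ↦ 1 - t h - h / (1 + r h)` on `[0, ∞)` are at most `-t`, so a
small residual forces closeness to the solution. -/
theorem mul_abs_sub_le_of_stieltjes_equation {t r h g : ℝ} (hr : 0 ≤ r) (hh : 0 ≤ h)
    (hg : 0 ≤ g) (ht : 0 ≤ t) :
    t * |h - g| ≤ |(1 - t * h - h / (1 + r * h)) - (1 - t * g - g / (1 + r * g))| := by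
  have h1 : 0 < 1 + r * h := by positivity
  have h2 : 0 < 1 + r * g := by positivity
  have : (1 - t * h - h / (1 + r * h)) - (1 - t * g - g / (1 + r * g)) =
      -((t + 1 / ((1 + r * h) * (1 + r * g))) * (h - g)) := by
    field_simp
    ring
  rw [this, abs_neg, abs_mul, abs_of_nonneg (by positivity : 0 ≤ t + _)]
  refine mul_le_mul_of_nonneg_right ?_ (abs_nonneg _)
  have : 0 ≤ 1 / ((1 + r * h) * (1 + r * g)) := by positivity
  linarith

/-- Convergence in probability of the Stieltjes transform of a real Gaussian Wishart matrix to the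
solution of the Marchenko–Pastur equation. -/
theorem tendsto_trace_wishartResolvent
    (hp : Tendsto (fun k => (Fintype.card (n k) : ℝ)) atTop atTop) {γ : ℝ} (hγ : 0 < γ)
    (hr : Tendsto (fun k => (Fintype.card (n k) : ℝ) / Fintype.card (m k)) atTop (𝓝 γ))
    {t g : ℝ} (ht : 0 < t) (hg : 0 ≤ g) (hgeq : 1 - t * g - g / (1 + γ * g) = 0) :
    Tendsto (fun ω : Σ k, Matrix (m k) (n k) ℝ =>
      (Fintype.card (m ω.1) : ℝ) / Fintype.card (n ω.1) *
        (wishartResolvent ω.2 (Fintype.card (m ω.1) * t)).trace)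
      (inProb fun k => iidMatrix (m k) (n k) (gaussianReal 0 1)) (𝓝 g) := by
  classical
  set N : ℕ → ℝ := fun k => Fintype.card (m k) with hN
  set p : ℕ → ℝ := fun k => Fintype.card (n k) with hpdef
  have hppos : ∀ᶠ k in atTop, 0 < p k := hp.eventually_gt_atTop 0
  have hNpos : ∀ᶠ k in atTop, 0 < N k := by
    filter_upwards [hr.eventually (lt_mem_nhds hγ)] with k hk
    by_contra h
    have h0 : N k = 0 := le_antisymm (not_lt.1 h) (Nat.cast_nonneg _)
    simp [hN] at h0
    simp [h0] at hk
  set H : (Σ k, Matrix (m k) (n k) ℝ) → ℝ := fun ω =>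
    N ω.1 / p ω.1 * (wishartResolvent ω.2 (N ω.1 * t)).trace with hH
  -- The residual of the equation at `H`, with the actual ratio `p / N` in place of `γ`. The
  -- resolvent estimates need a positive shift `N t`; the default value covers `N = 0`, which
  -- happens for finitely many `k` only.
  let Y : (Σ k, Matrix (m k) (n k) ℝ) → ℝ := fun ω => if 0 < N ω.1 then
    (p ω.1)⁻¹ * (p ω.1 - (N ω.1 * t) * (wishartResolvent ω.2 (N ω.1 * t)).trace -
      N ω.1 * ((wishartResolvent ω.2 (N ω.1 * t)).trace /
        (1 + (wishartResolvent ω.2 (N ω.1 * t)).trace))) else 0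
  have hb : Tendsto (fun k => (Real.sqrt gaussSqVar * (Real.sqrt (p k))⁻¹ + (p k)⁻¹) / t)
      atTop (𝓝 0) := by
    have h1 : Tendsto (fun k => (Real.sqrt (p k))⁻¹) atTop (𝓝 0) :=
      tendsto_inv_atTop_zero.comp (Real.tendsto_sqrt_atTop.comp hp)
    have h2 : Tendsto (fun k => (p k)⁻¹) atTop (𝓝 0) := tendsto_inv_atTop_zero.comp hp
    simpa using ((h1.const_mul (Real.sqrt gaussSqVar)).add h2).div_const t
  have hY : Tendsto Y (inProb fun k => iidMatrix (m k) (n k) (gaussianReal 0 1)) (𝓝 0) := by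
    refine tendsto_inProb_of_lintegral_le (fun k => ?_) hb ?_
    · by_cases h0 : 0 < N k
      · simp only [Y, h0, if_true]
        have := (continuous_wishartResolvent (m := m k) (n := n k)
          (mul_pos h0 ht)).matrix_trace.measurable
        exact ((measurable_const.sub (this.const_mul _)).sub
          ((this.div (this.const_add 1)).const_mul _)).const_mul _
      · simp only [Y, h0, if_false]
        exact measurable_const
    · filter_upwards [hppos, hNpos] with k hpk hNk
      have key := lintegral_abs_card_sub_trace_resolvent_le (m := m k) (n := n k) (mul_pos hNk ht)
      simp only [Y, hNk, if_true, abs_mul, abs_of_pos (inv_pos.2 hpk)]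
      simp_rw [ENNReal.ofReal_mul (inv_pos.2 hpk).le]
      rw [lintegral_const_mul' _ _ ENNReal.ofReal_ne_top]
      refine (mul_le_mul_right key _).trans (le_of_eq ?_)
      rw [← ENNReal.ofReal_mul (inv_pos.2 hpk).le]
      congr 1
      change (p k)⁻¹ * (N k * (Real.sqrt (gaussSqVar * p k) + 1) / (N k * t)) = _
      rw [Real.sqrt_mul (show 0 ≤ gaussSqVar from variance_nonneg _ _)]
      have hs : 0 < Real.sqrt (p k) := Real.sqrt_pos.2 hpk
      have hinv : (p k)⁻¹ * Real.sqrt (p k) = (Real.sqrt (p k))⁻¹ := by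
        rw [inv_mul_eq_div, Real.sqrt_div_self]
      rw [← hinv]
      field_simp
  -- The limit `g` solves the equation for `γ`, so its residual at the ratio `p / N` vanishes
  -- asymptotically.
  have he : Tendsto (fun k => 1 - t * g - g / (1 + p k / N k * g)) atTop (𝓝 0) := by
    rw [← hgeq]
    have h1 : 1 + γ * g ≠ 0 := by positivity
    exact tendsto_const_nhds.sub (tendsto_const_nhds.div
      (tendsto_const_nhds.add (hr.mul_const g)) h1)
  have hYe : Tendsto (fun ω => |Y ω - (1 - t * g - g / (1 + p ω.1 / N ω.1 * g))| / t)
      (inProb fun k => iidMatrix (m k) (n k) (gaussianReal 0 1)) (𝓝 0) := by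
    simpa using ((hY.sub (he.comp tendsto_fst_inProb)).abs).div_const t
  rw [tendsto_iff_norm_sub_tendsto_zero]
  refine squeeze_zero' (Eventually.of_forall fun _ => norm_nonneg _) ?_ hYe
  filter_upwards [tendsto_fst_inProb.eventually hppos, tendsto_fst_inProb.eventually hNpos]
    with ω hpω hNω
  rw [le_div_iff₀ ht, Real.norm_eq_abs, mul_comm]
  have hτ := trace_wishartResolvent_nonneg ω.2 (mul_pos hNω ht)
  have hH0 : 0 ≤ H ω := by simp only [hH]; positivity
  have e : Y ω = 1 - t * H ω - H ω / (1 + p ω.1 / N ω.1 * H ω) := by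
    have e1 : p ω.1 / N ω.1 * H ω = (wishartResolvent ω.2 (N ω.1 * t)).trace := by
      simp only [hH]; field_simp
    rw [e1]
    simp only [Y, hNω, if_true, hH]
    have : 1 + (wishartResolvent ω.2 (N ω.1 * t)).trace ≠ 0 := by positivity
    field_simp
  rw [e]
  exact mul_abs_sub_le_of_stieltjes_equation (by positivity) hH0 hg ht.le

/-- The Stieltjes transform, at `-t`, of the spectral distribution of `c Xᵀ X`. -/
noncomputable def wishartStieltjes {m n : Type*} [Fintype m] [Fintype n] [DecidableEq n]
    (X : Matrix m n ℝ) (c t : ℝ) : ℝ :=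
  (Fintype.card n : ℝ)⁻¹ *
    ∑ i, (c * (posSemidef_transpose_mul_self X).1.eigenvalues i + t)⁻¹

/-- Each eigenvalue `λ` contributes `|1 - c N| λ / ((c λ + t) (λ + N t))`, with the two factors
below at least `t` and `λ`. As the bound holds for every matrix, `c` may be random and correlated
with it. -/
theorem abs_wishartStieltjes_sub_le {m n : Type*} [Fintype m] [Fintype n] [DecidableEq n]
    (X : Matrix m n ℝ) {N c t : ℝ} (hN : 0 < N) (hc : 0 ≤ c) (ht : 0 < t) :
    |wishartStieltjes X c t - N / Fintype.card n * (wishartResolvent X (N * t)).trace| ≤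
      |1 - c * N| / t := by
  have hev := (posSemidef_transpose_mul_self X).eigenvalues_nonneg
  set lam := (posSemidef_transpose_mul_self X).1.eigenvalues with hlam
  rw [trace_wishartResolvent X (mul_pos hN ht), wishartStieltjes, div_eq_inv_mul, mul_assoc,
    ← mul_sub, Finset.mul_sum, ← Finset.sum_sub_distrib, abs_mul, abs_of_nonneg (by positivity)]
  have hterm : ∀ i, |(c * lam i + t)⁻¹ - N * (lam i + N * t)⁻¹| ≤ |1 - c * N| / t := by
    intro i
    have h0 := hev i
    have h1 : 0 < c * lam i + t := by positivity
    have h2 : 0 < lam i + N * t := by positivity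
    have : (c * lam i + t)⁻¹ - N * (lam i + N * t)⁻¹ =
        (1 - c * N) * (lam i / ((c * lam i + t) * (lam i + N * t))) := by
      field_simp
      ring
    rw [this, abs_mul, abs_of_nonneg (by positivity : 0 ≤ lam i / _), ← mul_one_div |1 - c * N| t]
    refine mul_le_mul_of_nonneg_left ?_ (abs_nonneg _)
    rw [div_le_div_iff₀ (by positivity) ht, one_mul, mul_comm]
    gcongr
    · linarith [mul_nonneg hc h0]
    · linarith [mul_pos hN ht]
  calc _ ≤ (Fintype.card n : ℝ)⁻¹ * ∑ _i : n, |1 - c * N| / t := by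
        gcongr
        exact (Finset.abs_sum_le_sum_abs _ _).trans (Finset.sum_le_sum fun i _ => hterm i)
    _ ≤ _ := by
      rw [Finset.sum_const, Finset.card_univ, nsmul_eq_mul]
      rcases Nat.eq_zero_or_pos (Fintype.card n) with h | h
      · rw [h]; simp; positivity
      · rw [inv_mul_cancel_left₀ (by positivity)]

/-- The Marchenko–Pastur limit for random matrices whose laws are Gaussian, with a random
normalization. -/
theorem tendsto_wishartStieltjes {Ω : ℕ → Type*} [∀ k, MeasurableSpace (Ω k)]
    {P : ∀ k, Measure (Ω k)} (F : ∀ k, Ω k → Matrix (m k) (n k) ℝ)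
    (hF : ∀ k, AEMeasurable (F k) (P k))
    (hlaw : ∀ k, (P k).map (F k) = iidMatrix (m k) (n k) (gaussianReal 0 1))
    (hp : Tendsto (fun k => (Fintype.card (n k) : ℝ)) atTop atTop) {γ : ℝ} (hγ : 0 < γ)
    (hr : Tendsto (fun k => (Fintype.card (n k) : ℝ) / Fintype.card (m k)) atTop (𝓝 γ))
    {c : (Σ k, Ω k) → ℝ} (hc0 : ∀ ω, 0 ≤ c ω)
    (hc : Tendsto (fun ω => c ω * Fintype.card (m ω.1)) (inProb P) (𝓝 1))
    {t g : ℝ} (ht : 0 < t) (hg : 0 ≤ g) (hgeq : 1 - t * g - g / (1 + γ * g) = 0) :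
    Tendsto (fun ω => wishartStieltjes (F ω.1 ω.2) (c ω) t) (inProb P) (𝓝 g) := by
  have h1 := (tendsto_trace_wishartResolvent hp hγ hr ht hg hgeq).comp
    (tendsto_map_inProb F hF hlaw)
  have h2 : Tendsto (fun ω => |1 - c ω * Fintype.card (m ω.1)| / t) (inProb P) (𝓝 0) := by
    simpa using ((hc.const_sub 1).abs).div_const t
  have hNpos : ∀ᶠ k in atTop, 0 < (Fintype.card (m k) : ℝ) := by
    filter_upwards [hr.eventually (lt_mem_nhds hγ)] with k hk
    refine lt_of_le_of_ne (Nat.cast_nonneg _) fun h => ?_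
    rw [← h] at hk
    simp at hk
  have h3 : Tendsto (fun ω : Σ k, Ω k => wishartStieltjes (F ω.1 ω.2) (c ω) t -
      (Fintype.card (m ω.1) : ℝ) / Fintype.card (n ω.1) *
        (wishartResolvent (F ω.1 ω.2) (Fintype.card (m ω.1) * t)).trace) (inProb P) (𝓝 0) := by
    refine squeeze_zero_norm' ?_ h2
    filter_upwards [tendsto_fst_inProb.eventually hNpos] with ω hω
    exact abs_wishartStieltjes_sub_le _ hω (hc0 ω) ht
  have h4 := h3.add h1
  rw [zero_add] at h4
  refine h4.congr fun ω => ?_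
  simp

end Asymptotics

/-! ### Laws of the Pauli coefficients under the GUE and the GOE -/

section Laws

open Matrix

variable {nA nB : ℕ}

theorem continuous_pauliCoeff (s : PauliString nA) (t : PauliString nB) :
    Continuous fun X : BiOp nA nB ℂ => pauliCoeff X s t :=
  (continuous_const.matrix_mul continuous_id).matrix_trace

theorem measurable_re_pauliCoeff (s : PauliString nA) (t : PauliString nB) :
    Measurable fun X : BiOp nA nB ℂ => (pauliCoeff X s t).re :=
  (Complex.continuous_re.comp (continuous_pauliCoeff s t)).measurable

theorem gue_map_pauliCoeff :
    (gue (Qubits nA × Qubits nB)).map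
      (fun (M : BiOp nA nB ℂ) (p : PauliString nA × PauliString nB) =>
        (pauliCoeff M p.1 p.2).re) = Measure.pi fun _ => gaussianReal 0 1 := by
  simp only [pauliCoeff_eq_trace]
  refine gue_map_trace (fun p : PauliString nA × PauliString nB => pauliOp p.1 ⊗ₖ pauliOp p.2)
    (fun p => ?_) fun p q => ?_
  · rw [IsHermitian, conjTranspose_kronecker, isHermitian_pauliOp, isHermitian_pauliOp]
  · rw [← mul_kronecker_mul, trace_kronecker, trace_pauliOp_mul, trace_pauliOp_mul]
    by_cases h1 : p.1 = q.1 <;> by_cases h2 : p.2 = q.2 <;> simp [h1, h2, Prod.ext_iff]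

/-- The matrix of real parts of the Pauli coefficients. -/
noncomputable def rePauliCoeff (M : BiOp nA nB ℂ) : Matrix (PauliString nA) (PauliString nB) ℝ :=
  fun s t => (pauliCoeff M s t).re

theorem measurable_rePauliCoeff : Measurable (rePauliCoeff : BiOp nA nB ℂ → _) :=
  measurable_pi_lambda _ fun s => measurable_pi_lambda _ fun t => measurable_re_pauliCoeff s t

theorem gue_map_rePauliCoeff :
    (gue (Qubits nA × Qubits nB)).map (rePauliCoeff : BiOp nA nB ℂ → _) =
      iidMatrix (PauliString nA) (PauliString nB) (gaussianReal 0 1) := by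
  rw [← map_curry_pi, ← gue_map_pauliCoeff, Measure.map_map measurable_curry_matrix]
  · rfl
  · exact measurable_pi_lambda _ fun p => measurable_re_pauliCoeff p.1 p.2

theorem measurable_map_re {ι : Type*} :
    Measurable fun M : Matrix ι ι ℂ => M.map Complex.re :=
  measurable_pi_lambda _ fun i => measurable_pi_lambda _ fun j =>
    Complex.measurable_re.comp ((measurable_pi_apply j).comp (measurable_pi_apply i))

theorem measurable_toComplexOp : Measurable (toComplexOp : BiOp nA nB ℝ → _) :=
  measurable_pi_lambda _ fun i => measurable_pi_lambda _ fun j =>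
    Complex.measurable_ofReal.comp ((measurable_pi_apply j).comp (measurable_pi_apply i))

theorem measurable_plusBlock : Measurable (plusBlock : BiOp nA nB ℝ → _) :=
  measurable_pi_lambda _ fun s => measurable_pi_lambda _ fun t =>
    (measurable_re_pauliCoeff s.1 t.1).comp measurable_toComplexOp

theorem measurable_minusBlock : Measurable (minusBlock : BiOp nA nB ℝ → _) :=
  measurable_pi_lambda _ fun s => measurable_pi_lambda _ fun t =>
    (measurable_re_pauliCoeff s.1 t.1).comp measurable_toComplexOp

theorem measurable_sum_curry {m n m' n' : Type*} :
    Measurable fun x : (m × n) ⊕ (m' × n') → ℝ =>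
      ((fun i j => x (Sum.inl (i, j)) : Matrix m n ℝ),
        (fun i j => x (Sum.inr (i, j)) : Matrix m' n' ℝ)) :=
  (measurable_pi_lambda _ fun _ => measurable_pi_lambda _ fun _ => measurable_pi_apply _).prodMk
    (measurable_pi_lambda _ fun _ => measurable_pi_lambda _ fun _ => measurable_pi_apply _)

theorem map_sum_curry_pi {m n m' n' : Type*} [Fintype m] [Fintype n] [Fintype m'] [Fintype n']
    (μ : Measure ℝ) [IsProbabilityMeasure μ] :
    (Measure.pi fun _ : (m × n) ⊕ (m' × n') => μ).map
      (fun x => ((fun i j => x (Sum.inl (i, j)) : Matrix m n ℝ),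
        (fun i j => x (Sum.inr (i, j)) : Matrix m' n' ℝ))) =
      (iidMatrix m n μ).prod (iidMatrix m' n' μ) := by
  let f : (m × n → ℝ) → Matrix m n ℝ := fun x i j => x (i, j)
  let f' : (m' × n' → ℝ) → Matrix m' n' ℝ := fun x i j => x (i, j)
  have hf : Measurable f := measurable_curry_matrix
  have hf' : Measurable f' := measurable_curry_matrix
  have h : (Measure.pi fun _ : m × n => μ).map f = iidMatrix m n μ := map_curry_pi μ
  have h' : (Measure.pi fun _ : m' × n' => μ).map f' = iidMatrix m' n' μ := map_curry_pi μ
  have hpair := measurePreserving_sumPiEquivProdPi (fun _ : (m × n) ⊕ (m' × n') => μ)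
  rw [← h, ← h', Measure.map_prod_map _ _ hf hf', ← hpair.map_eq,
    Measure.map_map (hf.prodMap hf') hpair.measurable]
  rfl

/-- The pairs of real and the pairs of imaginary Pauli strings, among all pairs. -/
def blockIndex (nA nB : ℕ) :
    (RePauli nA × RePauli nB) ⊕ (ImPauli nA × ImPauli nB) → PauliString nA × PauliString nB :=
  Sum.elim (fun p => (p.1.1, p.2.1)) (fun p => (p.1.1, p.2.1))

/-- No string is both real and imaginary, so the blocks use disjoint sets of independent GUE
coefficients; hence their independence. -/
theorem blockIndex_injective (nA nB : ℕ) : Function.Injective (blockIndex nA nB) := by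
  rintro (⟨s, t⟩ | ⟨s, t⟩) (⟨s', t'⟩ | ⟨s', t'⟩) h
  · simp only [blockIndex, Sum.elim_inl, Prod.mk.injEq] at h
    rw [Subtype.ext h.1, Subtype.ext h.2]
  · simp only [blockIndex, Sum.elim_inl, Sum.elim_inr, Prod.mk.injEq] at h
    exact absurd (h.1 ▸ s.2) (Nat.not_even_iff_odd.2 s'.2)
  · simp only [blockIndex, Sum.elim_inl, Sum.elim_inr, Prod.mk.injEq] at h
    exact absurd (h.1 ▸ s'.2) (Nat.not_even_iff_odd.2 s.2)
  · simp only [blockIndex, Sum.elim_inr, Prod.mk.injEq] at h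
    rw [Subtype.ext h.1, Subtype.ext h.2]

/-- The two blocks of a GOE matrix are independent and have i.i.d. standard Gaussian entries. -/
theorem goe_map_blocks :
    (goe (Qubits nA × Qubits nB)).map
      (fun M : BiOp nA nB ℝ => (plusBlock M, minusBlock M)) =
        (iidMatrix (RePauli nA) (RePauli nB) (gaussianReal 0 1)).prod
          (iidMatrix (ImPauli nA) (ImPauli nB) (gaussianReal 0 1)) := by
  let c : BiOp nA nB ℂ → PauliString nA × PauliString nB → ℝ := fun M p => (pauliCoeff M p.1 p.2).re
  have hc : Measurable c := measurable_pi_lambda _ fun p => measurable_re_pauliCoeff p.1 p.2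
  have he : Measurable fun x : PauliString nA × PauliString nB → ℝ => x ∘ blockIndex nA nB :=
    measurable_pi_lambda _ fun _ => measurable_pi_apply _
  have hlaw : ((gue (Qubits nA × Qubits nB)).map c).map (fun x => x ∘ blockIndex nA nB) =
      Measure.pi fun _ => gaussianReal 0 1 := by
    rw [gue_map_pauliCoeff, map_comp_pi_gaussianReal _ (blockIndex_injective nA nB)]
  rw [← map_sum_curry_pi, ← hlaw, goe,
    Measure.map_map (measurable_plusBlock.prodMk measurable_minusBlock) measurable_map_re,
    Measure.map_map he hc, Measure.map_map measurable_sum_curry (he.comp hc)]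
  congr 1
  funext M
  -- Real-real and imaginary-imaginary pairs have an even total number of `Y` factors, so taking the
  -- real part leaves their coefficients unchanged.
  refine Prod.ext (funext fun s => funext fun t => ?_) (funext fun s => funext fun t => ?_)
  · exact re_pauliCoeff_map_re M (s.2.add t.2)
  · exact re_pauliCoeff_map_re M (s.2.add_odd t.2)

theorem ae_isHermitian_gue {ι : Type*} [Fintype ι] : ∀ᵐ M ∂(gue ι), M.IsHermitian := by
  have hm : MeasurableSet {M : Matrix ι ι ℂ | M.IsHermitian} :=
    (isClosed_eq continuous_id.matrix_conjTranspose continuous_id).measurableSet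
  rw [gue, ae_map_iff measurable_gue_map.aemeasurable hm]
  refine Eventually.of_forall fun G => ?_
  rw [IsHermitian, conjTranspose_smul, conjTranspose_add, conjTranspose_conjTranspose, add_comm]
  congr 1
  rw [← Complex.ofReal_inv, Complex.star_def, Complex.conj_ofReal]

theorem ae_isSymm_goe {ι : Type*} [Fintype ι] : ∀ᵐ M ∂(goe ι), M.IsSymm := by
  have hm : MeasurableSet {M : Matrix ι ι ℝ | M.IsSymm} :=
    (isClosed_eq continuous_id.matrix_transpose continuous_id).measurableSet
  rw [goe, ae_map_iff measurable_map_re.aemeasurable hm]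
  filter_upwards [ae_isHermitian_gue] with M hM
  ext i j
  simp [← hM.apply i j]

end Laws

/-! ### Spectral distributions and Frobenius norms in terms of the blocks -/

section Spectrum

open Matrix

theorem roots_charpoly_real_smul {n : Type*} [Fintype n] [DecidableEq n] {A : Matrix n n ℂ}
    (hA : A.IsHermitian) (c : ℝ) :
    ((c : ℂ) • A).charpoly.roots = A.charpoly.roots.map fun z => (c : ℂ) * z := by
  have h : ((c : ℂ) • A).charpoly = (diagonal fun i => (c : ℂ) * hA.eigenvalues i).charpoly := by
    conv_lhs => rw [hA.spectral_theorem, Unitary.conjStarAlgAut_apply, ← Matrix.smul_mul,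
      ← Matrix.mul_smul, charpoly_mul_comm, ← Matrix.mul_assoc]
    simp only [Unitary.coe_star_mul_self, Matrix.one_mul]
    congr 1
    ext i j
    by_cases hij : i = j <;> simp [hij]
  rw [h, charpoly_diagonal, hA.roots_charpoly_eq_eigenvalues, Polynomial.roots_prod]
  · simp only [Polynomial.roots_X_sub_C, Multiset.bind_singleton, Multiset.map_map]
    rfl
  · exact Finset.prod_ne_zero_iff.2 fun _ _ => Polynomial.X_sub_C_ne_zero _

theorem sum_roots_charpoly_wishart {m n : Type*} [Fintype m] [Fintype n] [DecidableEq n]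
    (X : Matrix m n ℝ) (φ : ℝ → ℝ) :
    ((((Xᵀ * X).charpoly.map Complex.ofRealHom).roots).map fun z => φ z.re).sum =
      ∑ i, φ ((posSemidef_transpose_mul_self X).1.eigenvalues i) := by
  have hX := (posSemidef_transpose_mul_self X).1
  rw [hX.splits_charpoly.roots_map, hX.roots_charpoly_eq_eigenvalues]
  simp

/-- The product form remains valid for an empty index type, which does occur: there is no imaginary
string on zero qubits. -/
theorem card_mul_wishartStieltjes {m n : Type*} [Fintype m] [Fintype n] [DecidableEq n]
    (X : Matrix m n ℝ) (c t : ℝ) :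
    Fintype.card n * wishartStieltjes X c t =
      ∑ i, (c * (posSemidef_transpose_mul_self X).1.eigenvalues i + t)⁻¹ := by
  rw [wishartStieltjes]
  rcases isEmpty_or_nonempty n with h | h
  · simp
  · rw [mul_inv_cancel_left₀]
    exact_mod_cast Fintype.card_ne_zero

variable {nA nB : ℕ}

instance (X : BiOp nA nB ℂ) : IsProbabilityMeasure (oesDistribution X) := by
  refine ⟨?_⟩
  rw [oesDistribution, Measure.smul_apply, Measure.finsetSum_apply]
  simp only [measure_univ, Finset.sum_const, Finset.card_univ, nsmul_eq_mul, mul_one, smul_eq_mul]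
  exact ENNReal.inv_mul_cancel (by simp) (ENNReal.natCast_ne_top _)

open scoped ComplexOrder in
theorem oesDistribution_nonneg (X : BiOp nA nB ℂ) : ∀ᵐ x ∂(oesDistribution X), 0 ≤ x := by
  refine Measure.ae_smul_measure ?_ _
  rw [ae_finsetSum_measure_iff]
  intro i _
  rw [ae_dirac_iff measurableSet_Ici]
  exact (posSemidef_conjTranspose_mul_self (partialTranspose X)).eigenvalues_nonneg i

/-- Only the characteristic polynomial enters on the right, so identities and factorizations of it
pass directly to the spectral distribution. -/
theorem integral_oesDistribution (X : BiOp nA nB ℂ) (φ : ℝ → ℝ) :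
    ∫ x, φ x ∂(oesDistribution X) = (Fintype.card (PauliString nB) : ℝ)⁻¹ *
      ((oesWishart X).charpoly.roots.map fun z => φ z.re).sum := by
  have hX := isHermitian_conjTranspose_mul_self (partialTranspose X)
  rw [oesDistribution, integral_smul_measure, integral_finsetSum_measure fun i _ => ?_,
    show (oesWishart X).charpoly.roots = _ from hX.roots_charpoly_eq_eigenvalues]
  · simp [← mul_pow]
  · exact integrable_dirac (by simp)

/-- The factor by which the entanglement spectrum is rescaled in `normalizeOp`. -/
noncomputable def oesScale (X : BiOp nA nB ℂ) : ℝ := ((2 : ℝ) ^ nB / frobenius X) ^ 2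

theorem oesWishart_normalizeOp (X : BiOp nA nB ℂ) :
    oesWishart (normalizeOp X) = (oesScale X : ℂ) • oesWishart X := by
  ext i j
  simp only [oesWishart, mul_apply, conjTranspose_apply, partialTranspose, normalizeOp,
    Matrix.smul_apply,
    smul_eq_mul, star_mul', Complex.star_def, Complex.conj_ofReal, Finset.mul_sum, oesScale]
  refine Finset.sum_congr rfl fun k _ => ?_
  push_cast
  ring

theorem integral_oesDistribution_normalizeOp (X : BiOp nA nB ℂ) (φ : ℝ → ℝ) :
    ∫ x, φ x ∂(oesDistribution (normalizeOp X)) = (Fintype.card (PauliString nB) : ℝ)⁻¹ *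
      ((oesWishart X).charpoly.roots.map fun z => φ (oesScale X * z.re)).sum := by
  have hX : (oesWishart X).IsHermitian :=
    isHermitian_conjTranspose_mul_self (partialTranspose X)
  rw [integral_oesDistribution, oesWishart_normalizeOp, roots_charpoly_real_smul hX,
    Multiset.map_map]
  simp

theorem pauliCoeff_eq_map_of_isHermitian {X : BiOp nA nB ℂ} (hX : X.IsHermitian) :
    pauliCoeff X = (rePauliCoeff X).map Complex.ofReal := by
  ext s t
  exact (Complex.conj_eq_iff_re.1 (star_pauliCoeff_of_isHermitian hX s t)).symm

theorem stieltjes_oesDistribution_of_isHermitian {X : BiOp nA nB ℂ} (hX : X.IsHermitian) (t : ℝ) :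
    ∫ x, (x + t)⁻¹ ∂(oesDistribution (normalizeOp X)) =
      wishartStieltjes (rePauliCoeff X) (oesScale X) t := by
  have h : (oesWishart X).charpoly =
      ((rePauliCoeff X)ᵀ * rePauliCoeff X).charpoly.map Complex.ofRealHom := by
    rw [charpoly_oesWishart, pauliCoeff_eq_map_of_isHermitian hX, conjTranspose_map_ofReal_mul,
      ← charpoly_map]
    rfl
  rw [integral_oesDistribution_normalizeOp, h,
    sum_roots_charpoly_wishart _ fun x => (oesScale X * x + t)⁻¹]
  rfl

theorem stieltjes_oesDistribution_toComplexOp {M : BiOp nA nB ℝ} (hM : M.IsSymm) (t : ℝ) :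
    ∫ x, (x + t)⁻¹ ∂(oesDistribution (normalizeOp (toComplexOp M))) =
      (Fintype.card (RePauli nB) : ℝ) / Fintype.card (PauliString nB) *
        wishartStieltjes (plusBlock M) (oesScale (toComplexOp M)) t +
      (Fintype.card (ImPauli nB) : ℝ) / Fintype.card (PauliString nB) *
        wishartStieltjes (minusBlock M) (oesScale (toComplexOp M)) t := by
  rw [integral_oesDistribution_normalizeOp, charpoly_oesWishart_toComplexOp hM, Polynomial.map_mul,
    Polynomial.roots_mul (mul_ne_zero ((charpoly_monic _).map _).ne_zero
      ((charpoly_monic _).map _).ne_zero), Multiset.map_add, Multiset.sum_add,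
    sum_roots_charpoly_wishart _ fun x => (oesScale (toComplexOp M) * x + t)⁻¹,
    sum_roots_charpoly_wishart _ fun x => (oesScale (toComplexOp M) * x + t)⁻¹,
    ← card_mul_wishartStieltjes, ← card_mul_wishartStieltjes]
  ring

/-- The sum of the squares of the entries. -/
def sqSum {m n : Type*} [Fintype m] [Fintype n] (X : Matrix m n ℝ) : ℝ :=
  ∑ p : m × n, X p.1 p.2 ^ 2

theorem sqSum_nonneg {m n : Type*} [Fintype m] [Fintype n] (X : Matrix m n ℝ) : 0 ≤ sqSum X :=
  Finset.sum_nonneg fun _ _ => sq_nonneg _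

theorem trace_transpose_mul_self {m n : Type*} [Fintype m] [Fintype n] (X : Matrix m n ℝ) :
    (Xᵀ * X).trace = sqSum X := by
  simp only [Matrix.trace, diag_apply, mul_apply, transpose_apply, sqSum,
    Fintype.sum_prod_type_right, sq]

theorem trace_map_ofReal {n : Type*} [Fintype n] (A : Matrix n n ℝ) :
    (A.map Complex.ofReal).trace.re = A.trace := by
  simp [Matrix.trace]

theorem sq_frobenius_eq {X : BiOp nA nB ℂ} {S : ℝ} (hS : 0 ≤ S)
    (h : ((pauliCoeff X)ᴴ * pauliCoeff X).trace.re = S) : frobenius X ^ 2 = S := by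
  rw [frobenius, trace_conjTranspose_mul_self_eq, trace_oesWishart, h, Real.sq_sqrt hS]

theorem oesScale_of_isHermitian {X : BiOp nA nB ℂ} (hX : X.IsHermitian) :
    oesScale X = ((2 : ℝ) ^ nB) ^ 2 / sqSum (rePauliCoeff X) := by
  rw [oesScale, div_pow, sq_frobenius_eq (sqSum_nonneg (rePauliCoeff X))]
  rw [pauliCoeff_eq_map_of_isHermitian hX, conjTranspose_map_ofReal_mul, trace_map_ofReal,
    trace_transpose_mul_self]

theorem oesScale_toComplexOp {M : BiOp nA nB ℝ} (hM : M.IsSymm) :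
    oesScale (toComplexOp M) =
      ((2 : ℝ) ^ nB) ^ 2 / (sqSum (plusBlock M) + sqSum (minusBlock M)) := by
  rw [oesScale, div_pow, sq_frobenius_eq (add_nonneg (sqSum_nonneg (plusBlock M))
    (sqSum_nonneg (minusBlock M)))]
  rw [conjTranspose_pauliCoeff_mul_toComplexOp hM, trace_map_ofReal, zeroExtend_add,
    ← trace_transpose_mul_self, ← trace_transpose_mul_self]
  have h := Equiv.sum_comp (pauliSumEquiv nB).symm fun i => fromBlocks
    ((plusBlock M)ᵀ * plusBlock M) 0 0 ((minusBlock M)ᵀ * minusBlock M) i i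
  rw [Fintype.sum_sum_type] at h
  exact h

end Spectrum

/-! ### Law of large numbers for the squared entries -/

section LawOfLargeNumbers

theorem lintegral_abs_sqSum_div_sub_one_le {m n : Type*} [Fintype m] [Fintype n]
    (h : 0 < (Fintype.card m : ℝ) * Fintype.card n) :
    ∫⁻ X, ENNReal.ofReal |sqSum X / (Fintype.card m * Fintype.card n) - 1|
      ∂(iidMatrix m n (gaussianReal 0 1)) ≤
      ENNReal.ofReal (Real.sqrt gaussSqVar * (Real.sqrt (Fintype.card m * Fintype.card n))⁻¹) := by
  set N : ℝ := (Fintype.card m : ℝ) * Fintype.card n with hN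
  have hcard : (Fintype.card (m × n) : ℝ) = N := by rw [Fintype.card_prod, Nat.cast_mul]
  have key := lintegral_abs_sum_sq_sub_le (fun _ : m × n => N⁻¹) (inv_nonneg.2 h.le)
    fun _ => (abs_of_nonneg (inv_nonneg.2 h.le)).le
  have hmeas : Measurable fun x : m × n → ℝ =>
      ENNReal.ofReal |∑ i, N⁻¹ * x i ^ 2 - ∑ _i : m × n, N⁻¹| := by fun_prop
  rw [← map_uncurry_iidMatrix, lintegral_map hmeas measurable_uncurry_matrix, hcard,
    Finset.sum_const, Finset.card_univ, nsmul_eq_mul, hcard, mul_inv_cancel₀ h.ne'] at key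
  refine le_trans (le_of_eq ?_) (key.trans (ENNReal.ofReal_le_ofReal (le_of_eq ?_)))
  · refine lintegral_congr fun X => ?_
    rw [← Finset.mul_sum, ← div_eq_inv_mul]
    rfl
  · have h0 : 0 ≤ gaussSqVar := variance_nonneg _ _
    rw [Real.sqrt_mul h0, mul_comm, mul_assoc]
    congr 1
    have := Real.mul_self_sqrt h.le
    have h0 := Real.sqrt_pos.2 h
    field_simp
    rw [sq, this]

theorem measurable_sqSum {m n : Type*} [Fintype m] [Fintype n] :
    Measurable (sqSum : Matrix m n ℝ → ℝ) :=
  Finset.measurable_fun_sum _ fun p _ =>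
    ((measurable_pi_apply p.2).comp (measurable_pi_apply p.1)).pow_const 2

theorem tendsto_sqSum_div {m n : ℕ → Type} [∀ k, Fintype (m k)] [∀ k, Fintype (n k)]
    {Ω : ℕ → Type*} [∀ k, MeasurableSpace (Ω k)] {P : ∀ k, Measure (Ω k)}
    (F : ∀ k, Ω k → Matrix (m k) (n k) ℝ) (hF : ∀ k, AEMeasurable (F k) (P k))
    (hlaw : ∀ k, (P k).map (F k) = iidMatrix (m k) (n k) (gaussianReal 0 1))
    (h : Tendsto (fun k => (Fintype.card (m k) : ℝ) * Fintype.card (n k)) atTop atTop) :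
    Tendsto (fun ω : Σ k, Ω k => sqSum (F ω.1 ω.2) /
      (Fintype.card (m ω.1) * Fintype.card (n ω.1))) (inProb P) (𝓝 1) := by
  have key : Tendsto (fun ω : Σ k, Matrix (m k) (n k) ℝ => sqSum ω.2 /
      (Fintype.card (m ω.1) * Fintype.card (n ω.1)) - 1)
      (inProb fun k => iidMatrix (m k) (n k) (gaussianReal 0 1)) (𝓝 0) := by
    refine tendsto_inProb_of_lintegral_le
      (fun k => Measurable.sub_const (measurable_sqSum.div_const
        ((Fintype.card (m k) : ℝ) * Fintype.card (n k))) 1) (b := fun k =>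
      Real.sqrt gaussSqVar * (Real.sqrt (Fintype.card (m k) * Fintype.card (n k)))⁻¹) ?_ ?_
    · simpa using (Real.tendsto_sqrt_atTop.comp h).inv_tendsto_atTop.const_mul
        (Real.sqrt gaussSqVar)
    · filter_upwards [h.eventually_gt_atTop 0] with k hk
      exact lintegral_abs_sqSum_div_sub_one_le hk
  simpa using (key.comp (tendsto_map_inProb F hF hlaw)).add_const 1

end LawOfLargeNumbers

/-! ### Asymptotics of the dimensions and of the normalization -/

section Dimensions

variable {a b : ℕ → ℝ} {γ : ℝ}

theorem tendsto_atTop_of_pow_four (h : Tendsto (fun k => b k ^ 4) atTop atTop)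
    (hb : ∀ k, 0 < b k) : Tendsto b atTop atTop := by
  refine (Real.tendsto_sqrt_atTop.comp (Real.tendsto_sqrt_atTop.comp h)).congr fun k => ?_
  simp only [Function.comp_apply]
  rw [show b k ^ 4 = (b k ^ 2) ^ 2 by ring, Real.sqrt_sq (sq_nonneg _), Real.sqrt_sq (hb k).le]

/-- One has `a⁴ = (a b)² / (b² / a²)` and `b⁴ = (a b)² (b² / a²)`, and the ratio tends to a positive
finite limit. -/
theorem tendsto_atTop_of_ratio (ha : ∀ k, 0 < a k) (hb : ∀ k, 0 < b k) (hγ : 0 < γ)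
    (hab : Tendsto (fun k => a k * b k) atTop atTop)
    (h : Tendsto (fun k => b k ^ 2 / a k ^ 2) atTop (𝓝 γ)) :
    Tendsto a atTop atTop ∧ Tendsto b atTop atTop := by
  have hab2 : Tendsto (fun k => (a k * b k) ^ 2) atTop atTop :=
    (tendsto_pow_atTop two_ne_zero).comp hab
  constructor
  · refine tendsto_atTop_of_pow_four
      (((h.inv₀ hγ.ne').pos_mul_atTop (inv_pos.2 hγ) hab2).congr fun k => ?_) ha
    have := ha k
    have := hb k
    field_simp
  · refine tendsto_atTop_of_pow_four ((h.pos_mul_atTop hγ hab2).congr fun k => ?_) hb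
    have := ha k
    have := hb k
    field_simp

theorem mul_add_div_two_eq {x : ℝ} (hx : 0 < x) (σ : ℝ) :
    x * (x + σ) / 2 = x ^ 2 * ((1 + σ / x) / 2) := by
  field_simp

theorem tendsto_one_add_div (hb : Tendsto b atTop atTop) (σ : ℝ) :
    Tendsto (fun k => 1 + σ / b k) atTop (𝓝 1) := by
  simpa using (hb.const_div_atTop σ).const_add 1

theorem tendsto_block_dim_div_sq (hb0 : ∀ k, 0 < b k) (hb : Tendsto b atTop atTop) (σ : ℝ) :
    Tendsto (fun k => b k * (b k + σ) / 2 / b k ^ 2) atTop (𝓝 (1 / 2)) := by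
  refine ((tendsto_one_add_div hb σ).div_const 2).congr fun k => ?_
  rw [mul_add_div_two_eq (hb0 k), mul_div_cancel_left₀ _ (pow_pos (hb0 k) 2).ne']

theorem tendsto_block_dim_atTop (hb0 : ∀ k, 0 < b k) (hb : Tendsto b atTop atTop) (σ : ℝ) :
    Tendsto (fun k => b k * (b k + σ) / 2) atTop atTop := by
  refine (((tendsto_pow_atTop two_ne_zero).comp hb).atTop_mul_pos one_half_pos
    ((tendsto_one_add_div hb σ).div_const 2)).congr fun k => ?_
  rw [mul_add_div_two_eq (hb0 k)]
  rfl

theorem tendsto_block_ratio (ha0 : ∀ k, 0 < a k) (hb0 : ∀ k, 0 < b k)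
    (ha : Tendsto a atTop atTop) (hb : Tendsto b atTop atTop)
    (h : Tendsto (fun k => b k ^ 2 / a k ^ 2) atTop (𝓝 γ)) (σ τ : ℝ) :
    Tendsto (fun k => (b k * (b k + σ) / 2) / (a k * (a k + τ) / 2)) atTop (𝓝 γ) := by
  have := h.mul (((tendsto_one_add_div hb σ).div_const 2).div
    ((tendsto_one_add_div ha τ).div_const 2) (by norm_num))
  rw [div_self (by norm_num), mul_one] at this
  refine this.congr fun k => ?_
  rw [mul_add_div_two_eq (ha0 k), mul_add_div_two_eq (hb0 k), mul_div_mul_comm]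
  rfl

theorem card_pauliString_real (n : ℕ) : (Fintype.card (PauliString n) : ℝ) = ((2 : ℝ) ^ n) ^ 2 := by
  simp only [Fintype.card_pi, Fintype.card_fin, Finset.prod_const, Finset.card_univ]
  push_cast
  rw [← pow_mul, mul_comm, pow_mul]
  norm_num

theorem card_rePauli_real (n : ℕ) :
    (Fintype.card (RePauli n) : ℝ) = (2 : ℝ) ^ n * (2 ^ n + 1) / 2 := by
  rw [eq_div_iff two_ne_zero, mul_comm]
  exact_mod_cast (card_rePauli_imPauli n).1

/-- The shape `x (x + σ) / 2` lets one set of limits serve both blocks, with `σ = 1` and `σ = -1`.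
-/
theorem card_imPauli_real (n : ℕ) :
    (Fintype.card (ImPauli n) : ℝ) = (2 : ℝ) ^ n * (2 ^ n + -1) / 2 := by
  rw [eq_div_iff two_ne_zero, mul_comm, ← sub_eq_add_neg]
  have h := congrArg (Nat.cast (R := ℝ)) (card_rePauli_imPauli n).2
  rw [Nat.cast_mul, Nat.cast_mul, Nat.cast_sub Nat.one_le_two_pow] at h
  exact_mod_cast h

/-- In the application `S`, `S'` are the squared norms of blocks of sizes `N × p` and `N' × p'`, and
`q = d_B²`. Then `(S + S') / (q N)` tends to `1/2 + 1/2 = 1`. -/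
theorem tendsto_scale {Ω : Type*} {l : Filter Ω} {S S' N N' p p' q : Ω → ℝ}
    (hN : ∀ᶠ ω in l, N ω ≠ 0) (hN' : ∀ᶠ ω in l, N' ω ≠ 0) (hp : ∀ᶠ ω in l, p ω ≠ 0)
    (hp' : ∀ᶠ ω in l, p' ω ≠ 0)
    (hS : Tendsto (fun ω => S ω / (N ω * p ω)) l (𝓝 1))
    (hS' : Tendsto (fun ω => S' ω / (N' ω * p' ω)) l (𝓝 1))
    (hpq : Tendsto (fun ω => p ω / q ω) l (𝓝 (1 / 2)))
    (hpq' : Tendsto (fun ω => p' ω / q ω) l (𝓝 (1 / 2)))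
    (hNN : Tendsto (fun ω => N' ω / N ω) l (𝓝 1)) :
    Tendsto (fun ω => q ω / (S ω + S' ω) * N ω) l (𝓝 1) ∧
      Tendsto (fun ω => q ω / (S ω + S' ω) * N' ω) l (𝓝 1) := by
  have h := ((hS.mul hpq).add ((hS'.mul hpq').mul hNN)).inv₀ (by norm_num)
  norm_num at h
  have h1 : Tendsto (fun ω => q ω / (S ω + S' ω) * N ω) l (𝓝 1) := by
    refine h.congr' ?_
    filter_upwards [hN, hN', hp, hp'] with ω h1 h2 h3 h4
    have e1 : S ω / (N ω * p ω) * (p ω / q ω) = S ω / (q ω * N ω) := by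
      field_simp
    have e2 : S' ω / (N' ω * p' ω) * (p' ω / q ω) * (N' ω / N ω) = S' ω / (q ω * N ω) := by
      field_simp
    rw [e1, e2, ← add_div, inv_div, div_mul_eq_mul_div]
  refine ⟨h1, ?_⟩
  have h2 := h1.mul hNN
  rw [one_mul] at h2
  refine h2.congr' ?_
  filter_upwards [hN] with ω h1
  field_simp

end Dimensions

/-! ### The Marchenko–Pastur limit for the GUE and the GOE -/

section Limit

variable {γ : ℝ} {nA nB : ℕ → ℕ}

theorem exists_mpLaw_stieltjes_lt (hγ : 0 < γ) (hγ1 : γ ≤ 1) (ε : ℝ) (hε : 0 < ε) :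
    ∃ K : ℝ, 0 < K ∧ 1 - K * ∫ x, (x + K)⁻¹ ∂(mpLaw γ) < ε := by
  -- The last bound of `mpLaw_stieltjes` gives at most `(1 + ε⁻¹)⁻¹`, which is less than `ε`.
  refine ⟨ε⁻¹, inv_pos.2 hε, (mpLaw_stieltjes hγ hγ1 (inv_pos.2 hε)).2.2.trans_lt ?_⟩
  rw [inv_lt_comm₀ (by positivity) hε]
  linarith

theorem tendsto_two_pow_atTop (hγ : 0 < γ)
    (hd : Tendsto (fun k => nA k + nB k) atTop atTop)
    (hr : Tendsto (fun k => ((2 : ℝ) ^ nB k) ^ 2 / ((2 : ℝ) ^ nA k) ^ 2) atTop (𝓝 γ)) :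
    Tendsto (fun k => (2 : ℝ) ^ nA k) atTop atTop ∧
      Tendsto (fun k => (2 : ℝ) ^ nB k) atTop atTop := by
  refine tendsto_atTop_of_ratio (fun k => by positivity) (fun k => by positivity) hγ ?_ hr
  refine ((tendsto_pow_atTop_atTop_of_one_lt one_lt_two).comp hd).congr fun k => ?_
  exact pow_add _ _ _

theorem oesScale_nonneg {nA nB : ℕ} (X : BiOp nA nB ℂ) : 0 ≤ oesScale X := sq_nonneg _

theorem tendsto_integral_oesDistribution_gue (hγ : 0 < γ) (hγ1 : γ ≤ 1)
    (hd : Tendsto (fun k => nA k + nB k) atTop atTop)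
    (hr : Tendsto (fun k => ((2 : ℝ) ^ nB k) ^ 2 / ((2 : ℝ) ^ nA k) ^ 2) atTop (𝓝 γ))
    (f : BoundedContinuousFunction ℝ ℝ) :
    Tendsto (fun ω : Σ k, BiOp (nA k) (nB k) ℂ => ∫ x, f x ∂(oesDistribution (normalizeOp ω.2)))
      (inProb fun k => gue (Qubits (nA k) × Qubits (nB k))) (𝓝 (∫ x, f x ∂(mpLaw γ))) := by
  have : IsProbabilityMeasure (mpLaw γ) := isProbabilityMeasure_mpLaw hγ hγ1
  obtain ⟨ha, hb⟩ := tendsto_two_pow_atTop hγ hd hr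
  have ha2 := (tendsto_pow_atTop (α := ℝ) two_ne_zero).comp ha
  have hb2 := (tendsto_pow_atTop (α := ℝ) two_ne_zero).comp hb
  refine tendsto_integral_of_tendsto_stieltjes
    (μ := fun ω : Σ k, BiOp (nA k) (nB k) ℂ => oesDistribution (normalizeOp ω.2))
    (fun ω => oesDistribution_nonneg (normalizeOp ω.2)) (mpLaw_nonneg γ)
    (exists_mpLaw_stieltjes_lt hγ hγ1) (fun t ht => ?_) f
  obtain ⟨hg0, hg, -⟩ := mpLaw_stieltjes hγ hγ1 ht
  have hF (k : ℕ) := (measurable_rePauliCoeff (nA := nA k) (nB := nB k)).aemeasurable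
    (μ := gue (Qubits (nA k) × Qubits (nB k)))
  have hH : ∀ᶠ ω : Σ k, BiOp (nA k) (nB k) ℂ in
      inProb fun k => gue (Qubits (nA k) × Qubits (nB k)), ω.2.IsHermitian :=
    eventually_inProb_of_ae fun k => ae_isHermitian_gue
  have hS := tendsto_sqSum_div (fun k => rePauliCoeff) hF (fun k => gue_map_rePauliCoeff) (by
    simp only [card_pauliString_real]
    exact ha2.atTop_mul_atTop₀ hb2)
  refine (tendsto_wishartStieltjes (fun k => rePauliCoeff) hF (fun k => gue_map_rePauliCoeff)
    ?_ hγ ?_ (c := fun ω => oesScale ω.2) (fun ω => oesScale_nonneg _) ?_ ht hg0 hg).congr' ?_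
  · simp only [card_pauliString_real]
    exact hb2
  · simpa only [card_pauliString_real] using hr
  · have h := hS.inv₀ one_ne_zero
    rw [inv_one] at h
    refine h.congr' ?_
    filter_upwards [hH] with ω hω
    rw [oesScale_of_isHermitian hω, inv_div, card_pauliString_real, card_pauliString_real]
    ring
  · filter_upwards [hH] with ω hω
    exact (stieltjes_oesDistribution_of_isHermitian hω t).symm

theorem goe_map_plusBlock {nA nB : ℕ} :
    (goe (Qubits nA × Qubits nB)).map (plusBlock : BiOp nA nB ℝ → _) =
      iidMatrix (RePauli nA) (RePauli nB) (gaussianReal 0 1) := by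
  have h := congrArg (Measure.map Prod.fst) (goe_map_blocks (nA := nA) (nB := nB))
  rwa [Measure.map_map measurable_fst (measurable_plusBlock.prodMk measurable_minusBlock),
    Measure.map_fst_prod, measure_univ, one_smul] at h

theorem goe_map_minusBlock {nA nB : ℕ} :
    (goe (Qubits nA × Qubits nB)).map (minusBlock : BiOp nA nB ℝ → _) =
      iidMatrix (ImPauli nA) (ImPauli nB) (gaussianReal 0 1) := by
  have h := congrArg (Measure.map Prod.snd) (goe_map_blocks (nA := nA) (nB := nB))
  rwa [Measure.map_map measurable_snd (measurable_plusBlock.prodMk measurable_minusBlock),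
    Measure.map_snd_prod, measure_univ, one_smul] at h

theorem tendsto_integral_oesDistribution_goe (hγ : 0 < γ) (hγ1 : γ ≤ 1)
    (hd : Tendsto (fun k => nA k + nB k) atTop atTop)
    (hr : Tendsto (fun k => ((2 : ℝ) ^ nB k) ^ 2 / ((2 : ℝ) ^ nA k) ^ 2) atTop (𝓝 γ))
    (f : BoundedContinuousFunction ℝ ℝ) :
    Tendsto (fun ω : Σ k, BiOp (nA k) (nB k) ℝ =>
        ∫ x, f x ∂(oesDistribution (normalizeOp (toComplexOp ω.2))))
      (inProb fun k => goe (Qubits (nA k) × Qubits (nB k))) (𝓝 (∫ x, f x ∂(mpLaw γ))) := by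
  have : IsProbabilityMeasure (mpLaw γ) := isProbabilityMeasure_mpLaw hγ hγ1
  obtain ⟨ha, hb⟩ := tendsto_two_pow_atTop hγ hd hr
  have ha0 (k : ℕ) : 0 < (2 : ℝ) ^ nA k := by positivity
  have hb0 (k : ℕ) : 0 < (2 : ℝ) ^ nB k := by positivity
  have hN := tendsto_block_dim_atTop ha0 ha 1
  have hN' := tendsto_block_dim_atTop ha0 ha (-1)
  have hp := tendsto_block_dim_atTop hb0 hb 1
  have hp' := tendsto_block_dim_atTop hb0 hb (-1)
  have hpq := tendsto_block_dim_div_sq hb0 hb 1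
  have hpq' := tendsto_block_dim_div_sq hb0 hb (-1)
  -- Applied with `b = a`, where the ratio is constantly `1`: the two blocks have asymptotically the
  -- same number of rows.
  have hNN := tendsto_block_ratio ha0 ha0 ha ha
    (tendsto_const_nhds.congr fun k => (div_self (pow_pos (ha0 k) 2).ne').symm) (-1) 1
  have hpN := tendsto_block_ratio ha0 hb0 ha hb hr 1 1
  have hpN' := tendsto_block_ratio ha0 hb0 ha hb hr (-1) (-1)
  have hNp := hN.atTop_mul_atTop₀ hp
  have hNp' := hN'.atTop_mul_atTop₀ hp'
  simp only [← card_rePauli_real, ← card_imPauli_real] at hN hN' hp hp' hpq hpq'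
  simp only [← card_rePauli_real, ← card_imPauli_real] at hNN hpN hpN' hNp hNp'
  refine tendsto_integral_of_tendsto_stieltjes
    (μ := fun ω : Σ k, BiOp (nA k) (nB k) ℝ => oesDistribution (normalizeOp (toComplexOp ω.2)))
    (fun ω => oesDistribution_nonneg (normalizeOp (toComplexOp ω.2))) (mpLaw_nonneg γ)
    (exists_mpLaw_stieltjes_lt hγ hγ1) (fun t ht => ?_) f
  obtain ⟨hg0, hg, -⟩ := mpLaw_stieltjes hγ hγ1 ht
  have hF (k : ℕ) := (measurable_plusBlock (nA := nA k) (nB := nB k)).aemeasurable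
    (μ := goe (Qubits (nA k) × Qubits (nB k)))
  have hF' (k : ℕ) := (measurable_minusBlock (nA := nA k) (nB := nB k)).aemeasurable
    (μ := goe (Qubits (nA k) × Qubits (nB k)))
  have hH : ∀ᶠ ω : Σ k, BiOp (nA k) (nB k) ℝ in
      inProb fun k => goe (Qubits (nA k) × Qubits (nB k)), ω.2.IsSymm :=
    eventually_inProb_of_ae fun k => ae_isSymm_goe
  have hfst := tendsto_fst_inProb (P := fun k => goe (Qubits (nA k) × Qubits (nB k)))
  have hS := tendsto_sqSum_div (fun k => plusBlock) hF (fun k => goe_map_plusBlock) hNp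
  have hS' := tendsto_sqSum_div (fun k => minusBlock) hF' (fun k => goe_map_minusBlock) hNp'
  have hscale := tendsto_scale (hfst.eventually (hN.eventually_ne_atTop 0))
    (hfst.eventually (hN'.eventually_ne_atTop 0)) (hfst.eventually (hp.eventually_ne_atTop 0))
    (hfst.eventually (hp'.eventually_ne_atTop 0)) hS hS' (hpq.comp hfst) (hpq'.comp hfst)
    (hNN.comp hfst)
  have h1 := tendsto_wishartStieltjes (fun k => plusBlock) hF (fun k => goe_map_plusBlock)
    hp hγ hpN (c := fun ω => oesScale (toComplexOp ω.2)) (fun ω => oesScale_nonneg _) (by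
      refine hscale.1.congr' ?_
      filter_upwards [hH] with ω hω
      rw [oesScale_toComplexOp hω]) ht hg0 hg
  have h2 := tendsto_wishartStieltjes (fun k => minusBlock) hF' (fun k => goe_map_minusBlock)
    hp' hγ hpN' (c := fun ω => oesScale (toComplexOp ω.2)) (fun ω => oesScale_nonneg _) (by
      refine hscale.2.congr' ?_
      filter_upwards [hH] with ω hω
      rw [oesScale_toComplexOp hω]) ht hg0 hg
  -- Both blocks have the same limit `g`, and their weights tend to `1/2` each, so the weighted sum
  -- tends to `g`.
  have h := ((hpq.comp hfst).mul h1).add ((hpq'.comp hfst).mul h2)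
  rw [← add_mul, add_halves, one_mul] at h
  refine h.congr' ?_
  filter_upwards [hH] with ω hω
  rw [stieltjes_oesDistribution_toComplexOp hω t, card_pauliString_real]
  rfl

end Limit

end OperatorSchmidt

theorem mainTheorem5 :
    -- the numbers of real and of imaginary Pauli strings, with `d = 2 ^ n`
    (∀ n : ℕ,
      Fintype.card (RePauli n) = 2 ^ n * (2 ^ n + 1) / 2 ∧
      Fintype.card (ImPauli n) = 2 ^ n * (2 ^ n - 1) / 2) ∧
    -- the block structure for every bipartition `d_A = 2 ^ nA`, `d_B = 2 ^ nB`
    (∀ nA nB : ℕ,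
      -- all Pauli coefficients outside the two diagonal blocks vanish, those inside are real
      (∀ᵐ M ∂(goe (Qubits nA × Qubits nB)),
        pauliCoeff (toComplexOp M) =
          (zeroExtend (plusBlock M) + zeroExtend (minusBlock M)).map Complex.ofReal) ∧
      -- the two blocks are independent and have i.i.d. standard real Gaussian entries
      (goe (Qubits nA × Qubits nB)).map (fun M => (plusBlock M, minusBlock M)) =
        (iidMatrix (RePauli nA) (RePauli nB) (gaussianReal 0 1)).prod
          (iidMatrix (ImPauli nA) (ImPauli nB) (gaussianReal 0 1)) ∧
      -- the Wishart matrix is the sum of the Wishart matrices of the blocks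
      (∀ᵐ M ∂(goe (Qubits nA × Qubits nB)),
        (pauliCoeff (toComplexOp M)).conjTranspose * pauliCoeff (toComplexOp M) =
          (zeroExtend ((plusBlock M).transpose * plusBlock M) +
            zeroExtend ((minusBlock M).transpose * minusBlock M)).map Complex.ofReal) ∧
      -- the operator entanglement spectrum is the union of the spectra of the two summands
      (∀ᵐ M ∂(goe (Qubits nA × Qubits nB)),
        (oesWishart (toComplexOp M)).charpoly =
          (((plusBlock M).transpose * plusBlock M).charpoly *
            ((minusBlock M).transpose * minusBlock M).charpoly).map Complex.ofRealHom)) ∧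
    -- the limiting spectral distribution, for the GOE and for the GUE
    (∀ (γ : ℝ), 0 < γ → γ ≤ 1 → ∀ nA nB : ℕ → ℕ,
      Tendsto (fun k => nA k + nB k) atTop atTop →
      Tendsto (fun k => ((2 : ℝ) ^ nB k) ^ 2 / ((2 : ℝ) ^ nA k) ^ 2) atTop (𝓝 γ) →
      ∀ f : BoundedContinuousFunction ℝ ℝ, ∀ ε : ℝ, 0 < ε →
        Tendsto (fun k => goe (Qubits (nA k) × Qubits (nB k))
          {M | ε ≤ |∫ x, f x ∂(oesDistribution (normalizeOp (toComplexOp M))) -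
            ∫ x, f x ∂(mpLaw γ)|}) atTop (𝓝 0) ∧
        Tendsto (fun k => gue (Qubits (nA k) × Qubits (nB k))
          {M | ε ≤ |∫ x, f x ∂(oesDistribution (normalizeOp M)) -
            ∫ x, f x ∂(mpLaw γ)|}) atTop (𝓝 0)) := by
  refine ⟨fun n => ?_, fun nA nB => ⟨?_, goe_map_blocks, ?_, ?_⟩,
    fun γ hγ hγ1 nA nB hd hr f ε hε => ⟨?_, ?_⟩⟩
  · obtain ⟨h1, h2⟩ := card_rePauli_imPauli n
    constructor
    · rw [← h1, Nat.mul_div_cancel_left _ two_pos]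
    · rw [← h2, Nat.mul_div_cancel_left _ two_pos]
  · filter_upwards [ae_isSymm_goe] with M hM using pauliCoeff_toComplexOp hM
  · filter_upwards [ae_isSymm_goe] with M hM using conjTranspose_pauliCoeff_mul_toComplexOp hM
  · filter_upwards [ae_isSymm_goe] with M hM using charpoly_oesWishart_toComplexOp hM
  · exact tendsto_measure_of_tendsto_inProb
      (tendsto_integral_oesDistribution_goe hγ hγ1 hd hr f) hε
  · exact tendsto_measure_of_tendsto_inProb
      (tendsto_integral_oesDistribution_gue hγ hγ1 hd hr f) hε
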